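/- An \emph{ep-groupoid} $X$ is a groupoid (small category in which all morphisms are invertible) whose object set $X$ and morphism set $\mathbf X$ carry M-polyfold structures (Hausdorff, second countable, paracompact spaces with a maximal atlas of sc-smoothly compatible charts onto open subsets of splicing cores of sc-smooth splicings), such that all structure maps (source $s$, target $t$, unit, inverse, and multiplication, the latter on the fibered product of composable pairs with its natural M-polyfold structure) are sc-smooth, $s$ and $t$ are surjective local sc-diffeomorphisms, and every object $x$ has an open neighborhood $V(x)$ for which $t:s^{-1}(\overline{V(x)})\to X$ is proper. A functor between ep-groupoids is \emph{sc-smooth} if it is sc-smooth on objects and on morphisms. An sc-smooth functor $F:X\to Y$ is an \emph{equivalence} if it is a local sc-diffeomorphism on objects and on morphisms, the induced map $|F|:|X|\to|Y|$ of orbit spaces is an sc-homeomorphism (a homeomorphism which together with its inverse preserves the level filtrations), and $F$ induces a bijection $\mathbf X(x)\to\mathbf Y(F(x))$ of isotropy groups for every object $x$. For functors $F:X\to Y$ and $G:Z\to Y$ the \emph{weak fibered product} $L=X\times_Y Z$ is the groupoid with object set $$L=\{(x,\varphi,z)\in X\times\mathbf Y\times Z \mid s(\varphi)=F(x),\ t(\varphi)=G(z)\}$$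 and morphism set $$\mathbf L=\{(h,\varphi,k)\in\mathbf X\times\mathbf Y\times\mathbf Z\mid s(F(h))=s(\varphi),\ t(\varphi)=s(G(k))\},$$ with $s(h,\varphi,k)=(s(h),\varphi,s(k))$, $t(h,\varphi,k)=(t(h),\varphi',t(k))$ where $\varphi'=G(k)\circ\varphi\circ F(h)^{-1}$, units $(1_x,\varphi,1_z)$, inverses $(h^{-1},\varphi',k^{-1})$ and composition $(h,\varphi,k)\circ(h',\psi,k')=(h\circ h',\psi,k\circ k')$. \textbf{Theorem.} Let $X$, $Y$, $Z$ be ep-groupoids, let $F:X\to Y$ be an equivalence and let $G:Z\to Y$ be an sc-smooth functor. Then the weak fibered product $X\times_Y Z$ is in a natural way an ep-groupoid: there is exactly one ep-groupoid structure on it for which $L$ and $\mathbf L$ carry the subspace topologies from $X\times\mathbf Y\times Z$ and $\mathbf X\times\mathbf Y\times\mathbf Z$ and for which a map from an M-polyfold into $L$ (respectively $\mathbf L$) is sc-smooth if and only if its three components are sc-smooth. Moreover, with this structure the projection functor $p:X\times_Y Z\to Z$, $(x,\varphi,z)\mapsto z$, $(h,\varphi,k)\mapsto k$, is an equivalence.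 -/

import Mathlib

open Set Topology

universe u

namespace ScGeom

/-! ## sc-Banach spaces -/

/-- The composition `L m → L (m - 1) → ... → L 0` of the maps of a sequence. -/
noncomputable def toBottom {L : ℕ → Type u} [∀ m, NormedAddCommGroup (L m)]
    [∀ m, NormedSpace ℝ (L m)] (ι : ∀ m, L (m + 1) →L[ℝ] L m) : ∀ m, L m →L[ℝ] L 0
  | 0 => ContinuousLinearMap.id ℝ (L 0)
  | m + 1 => (toBottom ι m).comp (ι m)

/-- An sc-Banach space: a nested sequence of real Banach spaces
`lvl 0 ⊃ lvl 1 ⊃ lvl 2 ⊃ ...` (the inclusions being injective bounded linear maps) such that each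
inclusion is a compact operator and the intersection of all levels is dense in every level. -/
structure ScBanach : Type (u + 1) where
  lvl : ℕ → Type u
  [normed : ∀ m, NormedAddCommGroup (lvl m)]
  [space : ∀ m, NormedSpace ℝ (lvl m)]
  [complete : ∀ m, CompleteSpace (lvl m)]
  incl : ∀ m, lvl (m + 1) →L[ℝ] lvl m
  incl_injective : ∀ m, Function.Injective (incl m)
  incl_compact : ∀ m, IsCompactOperator (incl m)
  dense_smooth : ∀ m,
    Dense {x : lvl m | ∀ n, ∃ y : lvl n, toBottom incl n y = toBottom incl m x}

attribute [instance] ScBanach.normed ScBanach.space ScBanach.complete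

namespace ScBanach

/-- The inclusion of level `m` into level `0`. -/
noncomputable def toZero (E : ScBanach.{u}) (m : ℕ) : E.lvl m →L[ℝ] E.lvl 0 :=
  toBottom E.incl m

theorem toZero_zero (E : ScBanach.{u}) (x : E.lvl 0) : E.toZero 0 x = x := rfl

theorem toZero_succ (E : ScBanach.{u}) (m : ℕ) (x : E.lvl (m + 1)) :
    E.toZero (m + 1) x = E.toZero m (E.incl m x) := rfl

/-- A point of level `m` is smooth if it lies in all levels. -/
def IsSmoothPt (E : ScBanach.{u}) (m : ℕ) (x : E.lvl m) : Prop :=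
  ∀ n, ∃ y : E.lvl n, E.toZero n y = E.toZero m x

theorem dense_isSmoothPt (E : ScBanach.{u}) (m : ℕ) : Dense {x : E.lvl m | E.IsSmoothPt m x} :=
  E.dense_smooth m

theorem toZero_injective (E : ScBanach.{u}) (m : ℕ) : Function.Injective (E.toZero m) := by
  induction m with
  | zero => exact fun x y h => h
  | succ k ih => exact fun x y h => E.incl_injective k (ih h)

/-- The sc-space `E¹`, whose level `m` is the level `m + 1` of `E`. -/
@[reducible] noncomputable def shift (E : ScBanach.{u}) : ScBanach.{u} where
  lvl m := E.lvl (m + 1)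
  incl m := E.incl (m + 1)
  incl_injective m := E.incl_injective (m + 1)
  incl_compact m := E.incl_compact (m + 1)
  dense_smooth := by
    set J : ∀ n, E.lvl (n + 1) →L[ℝ] E.lvl 1 :=
      toBottom (L := fun m => E.lvl (m + 1)) fun m => E.incl (m + 1)
    have key : ∀ n (y : E.lvl (n + 1)), E.incl 0 (J n y) = E.toZero (n + 1) y := by
      intro n
      induction n with
      | zero => intro y; rfl
      | succ k ih => intro y; exact ih (E.incl (k + 1) y)
    intro m
    refine (E.dense_isSmoothPt (m + 1)).mono ?_
    intro x hx n
    obtain ⟨y, hy⟩ := hx (n + 1)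
    refine ⟨y, E.incl_injective 0 ?_⟩
    exact (key n y).trans (hy.trans (key m x).symm)

/-- The direct sum `E ⊕ F`, with levels `E_m × F_m`. -/
@[reducible] noncomputable def prod (E F : ScBanach.{u}) : ScBanach.{u} where
  lvl m := E.lvl m × F.lvl m
  incl m := (E.incl m).prodMap (F.incl m)
  incl_injective m := (E.incl_injective m).prodMap (F.incl_injective m)
  incl_compact m := by
    obtain ⟨K, hK, hK'⟩ := E.incl_compact m
    obtain ⟨L, hL, hL'⟩ := F.incl_compact m
    exact ⟨K ×ˢ L, hK.prod hL, prod_mem_nhds hK' hL'⟩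
  dense_smooth := by
    set J : ∀ n, E.lvl n × F.lvl n →L[ℝ] E.lvl 0 × F.lvl 0 :=
      toBottom (L := fun m => E.lvl m × F.lvl m) fun m => (E.incl m).prodMap (F.incl m)
    have key : ∀ n (y : E.lvl n × F.lvl n), J n y = (E.toZero n y.1, F.toZero n y.2) := by
      intro n
      induction n with
      | zero => intro y; rfl
      | succ k ih => intro y; exact ih (E.incl k y.1, F.incl k y.2)
    intro m
    refine ((E.dense_isSmoothPt m).prod (F.dense_isSmoothPt m)).mono ?_
    rintro x ⟨hx1, hx2⟩ n
    obtain ⟨y, hy⟩ := hx1 n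
    obtain ⟨z, hz⟩ := hx2 n
    refine ⟨(y, z), ?_⟩
    exact (key n (y, z)).trans ((Prod.ext hy hz).trans (key m x).symm)

/-- The tangent `TE = E¹ ⊕ E`, with levels `E_{m+1} × E_m`. -/
@[reducible] noncomputable def tangent (E : ScBanach.{u}) : ScBanach.{u} := E.shift.prod E

end ScBanach

/-! ## sc-smooth maps between subsets of sc-Banach spaces -/

/-- The part `U_m` of `U` lying in level `m`. -/
def levelSet {E : ScBanach.{u}} (U : Set (E.lvl 0)) (m : ℕ) : Set (E.lvl m) :=
  E.toZero m ⁻¹' U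

/-- The tangent `TU = U¹ ⊕ E` (as a subset of level `0` of `TE`). -/
def tangentSet {E : ScBanach.{u}} (U : Set (E.lvl 0)) : Set (E.tangent.lvl 0) :=
  {p | E.incl 0 p.1 ∈ U}

/-- A map given by its restrictions `f m : U_m → F_m` to the levels is of class sc⁰ if these
restrictions are continuous (and are restrictions of one and the same map). -/
def IsSc0 {E F : ScBanach.{u}} (U : Set (E.lvl 0)) (f : ∀ m, E.lvl m → F.lvl m) : Prop :=
  (∀ m, ContinuousOn (f m) (levelSet U m)) ∧
    ∀ m, ∀ x ∈ levelSet U (m + 1), F.incl m (f (m + 1) x) = f m (E.incl m x)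

/-- The class sc^k. The map `f` is of class sc^(k+1) if it is of class sc⁰, if at every `x ∈ U_1`
there is a bounded linear operator `Df(x) : E_0 → F_0` with
`‖f(x+h) - f(x) - Df(x)h‖_0 / ‖h‖_1 → 0` as `‖h‖_1 → 0`, and if the tangent map
`Tf : TU → TF`, `(x, h) ↦ (f(x), Df(x)h)` is of class sc^k. The datum `D m` is the
restriction `U_{m+1} × E_m → F_m` of `(x, h) ↦ Df(x)h`. -/
def IsSc : ℕ → ∀ (E F : ScBanach.{u}), Set (E.lvl 0) → (∀ m, E.lvl m → F.lvl m) → Prop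
  | 0, _, _, U, f => IsSc0 U f
  | k + 1, E, F, U, f => IsSc0 U f ∧
      ∃ D : ∀ m, E.lvl (m + 1) → E.lvl m → F.lvl m,
        (∀ x ∈ levelSet U 1, ∃ A : E.lvl 0 →L[ℝ] F.lvl 0, (∀ h, D 0 x h = A h) ∧
          HasFDerivWithinAt (fun y : E.lvl 1 => f 0 (E.incl 0 y)) (A.comp (E.incl 0))
            (levelSet U 1) x) ∧
        IsSc k E.tangent F.tangent (tangentSet U) (fun m p => (f (m + 1) p.1, D m p.1 p.2))

/-- A map `f : U → F` is sc-smooth if it restricts to the levels and is of class sc^k for all `k`.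
(To be used for relatively open subsets `U` of partial quadrants.) -/
def ScSmoothOn {E F : ScBanach.{u}} (U : Set (E.lvl 0)) (f : E.lvl 0 → F.lvl 0) : Prop :=
  ∃ fl : ∀ m, E.lvl m → F.lvl m, EqOn (fl 0) f U ∧ ∀ k, IsSc k E F U fl

/-- `C ⊂ E` is a partial quadrant: some linear sc-isomorphism `E ≅ ℝⁿ ⊕ Q` maps `C` onto
`[0,∞)ⁿ ⊕ Q`. -/
def IsPartialQuadrant {E : ScBanach.{u}} (C : Set (E.lvl 0)) : Prop :=
  ∃ (n : ℕ) (Q : ScBanach.{u}) (T : ∀ m, E.lvl m ≃L[ℝ] (Fin n → ℝ) × Q.lvl m),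
    (∀ m (x : E.lvl (m + 1)),
      T m (E.incl m x) = ((T (m + 1) x).1, Q.incl m (T (m + 1) x).2)) ∧
    C = {x | ∀ i, 0 ≤ (T 0 x).1 i}

/-! ## Splicings and M-polyfolds -/

/-- An sc-smooth splicing `(π, E, V)`: `V` is an open subset of a partial quadrant `C` in the
sc-Banach space `W`, and `(π_v)` for `v ∈ V` is a family of bounded linear projections of `E` such
that `V ⊕ E → E`, `(v, e) ↦ π_v e` is sc-smooth. -/
structure Splicing : Type (u + 1) where
  W : ScBanach.{u}
  E : ScBanach.{u}
  C : Set (W.lvl 0)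
  V : Set (W.lvl 0)
  quadrant : IsPartialQuadrant C
  isOpen_V : ∃ O : Set (W.lvl 0), IsOpen O ∧ V = O ∩ C
  π : W.lvl 0 → E.lvl 0 →L[ℝ] E.lvl 0
  proj : ∀ v ∈ V, ∀ e, π v (π v e) = π v e
  smooth : ScSmoothOn (E := W.prod E) (F := E) {p | p.1 ∈ V} (fun p => π p.1 p.2)

namespace Splicing

/-- The sc-Banach space `W ⊕ E` in which the splicing core lies. -/
@[reducible] noncomputable def ambient (S : Splicing.{u}) : ScBanach.{u} := S.W.prod S.E

/-- The retraction `(v, e) ↦ (v, π_v e)`. -/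
def retr (S : Splicing.{u}) (p : S.ambient.lvl 0) : S.ambient.lvl 0 := (p.1, S.π p.1 p.2)

/-- The splicing core `K = {(v, e) ∈ V ⊕ E | π_v e = e}`, with the topology induced from
`W_0 × E_0`. -/
def core (S : Splicing.{u}) : Set (S.ambient.lvl 0) := {p | p.1 ∈ S.V ∧ S.π p.1 p.2 = p.2}

/-- A map `f : O → K'` from an open subset `O` of a splicing core into another splicing core is
sc-smooth if `(v, e) ↦ f(v, π_v e)` is sc-smooth as a map `{(v, e) | (v, π_v e) ∈ O} → W' ⊕ E'`. -/
def ScSmoothOnCore (S S' : Splicing.{u}) (O : Set S.core) (f : S.core → S'.core) : Prop :=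
  ∃ g : S.ambient.lvl 0 → S'.ambient.lvl 0,
    (∀ (p : S.ambient.lvl 0) (hp : S.retr p ∈ S.core), (⟨S.retr p, hp⟩ : S.core) ∈ O →
      g p = (f ⟨S.retr p, hp⟩ : S'.ambient.lvl 0)) ∧
    ScSmoothOn {p | ∃ hp : S.retr p ∈ S.core, (⟨S.retr p, hp⟩ : S.core) ∈ O} g

end Splicing

/-- A chart of `X`: a homeomorphism of an open subset of `X` onto an open subset of a splicing
core. -/
structure Chart (X : Type u) [TopologicalSpace X] : Type (u + 1) where
  S : Splicing.{u}
  φ : OpenPartialHomeomorph X S.core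

/-- The coordinate representation `d ∘ f ∘ c⁻¹` of `f : U → Y` in the charts `c`, `d` is
sc-smooth where it is defined. -/
def ScSmoothInCharts {X Y : Type u} [TopologicalSpace X] [TopologicalSpace Y]
    (c : Chart X) (d : Chart Y) (f : X → Y) (U : Set X) : Prop :=
  c.S.ScSmoothOnCore d.S
    {q | q ∈ c.φ.target ∧ c.φ.symm q ∈ U ∧ f (c.φ.symm q) ∈ d.φ.source}
    (fun q => d.φ (f (c.φ.symm q)))

/-- Two charts are compatible if both transition maps are sc-smooth. -/
def Chart.Compatible {X : Type u} [TopologicalSpace X] (c d : Chart X) : Prop :=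
  ScSmoothInCharts c d id univ ∧ ScSmoothInCharts d c id univ

/-- An M-polyfold structure on the topological space `X`: `X` is Hausdorff, second countable and
paracompact, and is equipped with a maximal atlas of sc-smoothly compatible charts. -/
@[ext] class MPolyfold (X : Type u) [TopologicalSpace X] : Type (u + 1) where
  atlas : Set (Chart X)
  t2 : T2Space X
  secondCountable : SecondCountableTopology X
  paracompact : ParacompactSpace X
  covers : ∀ x : X, ∃ c ∈ atlas, x ∈ c.φ.source
  compatible : ∀ c ∈ atlas, ∀ d ∈ atlas, c.Compatible d
  maximal : ∀ c : Chart X, (∀ d ∈ atlas, c.Compatible d) → c ∈ atlas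

section Maps

variable {X Y : Type u} [TopologicalSpace X] [MPolyfold X] [TopologicalSpace Y] [MPolyfold Y]

/-- sc-smoothness of `f` on the open subset `U` of the M-polyfold `X`. -/
def ScSmoothOnOpen (f : X → Y) (U : Set X) : Prop :=
  ContinuousOn f U ∧
    ∀ c ∈ MPolyfold.atlas (X := X), ∀ d ∈ MPolyfold.atlas (X := Y), ScSmoothInCharts c d f U

/-- sc-smooth maps between M-polyfolds. -/
def ScSmooth (f : X → Y) : Prop := ScSmoothOnOpen f univ

/-- Local sc-diffeomorphisms: near every point, `f` is an sc-diffeomorphism from an open set onto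
an open set. -/
def IsLocalScDiffeo (f : X → Y) : Prop :=
  ∀ x : X, ∃ e : OpenPartialHomeomorph X Y, x ∈ e.source ∧ EqOn f e e.source ∧
    ScSmoothOnOpen e e.source ∧ ScSmoothOnOpen e.symm e.target

/-- The subset `X_m` of points of level `m` of an M-polyfold. -/
def polyLevel (X : Type u) [TopologicalSpace X] [MPolyfold X] (m : ℕ) : Set X :=
  {x | ∃ c ∈ MPolyfold.atlas (X := X), x ∈ c.φ.source ∧
    (c.φ x : c.S.ambient.lvl 0) ∈ range (c.S.ambient.toZero m)}

end Maps

/-- `P`, with the maps `a` and `b`, carries the natural M-polyfold structure of a subset of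
`A × B`: it has the subspace topology, and a map into `P` is sc-smooth exactly if its two
components are. -/
structure IsNaturalIn₂ {P A B : Type u} [TopologicalSpace P] [MPolyfold P] [TopologicalSpace A]
    [MPolyfold A] [TopologicalSpace B] [MPolyfold B] (a : P → A) (b : P → B) : Prop where
  embedding : IsEmbedding (fun p => (a p, b p))
  scSmooth_iff : ∀ (M : Type u) [TopologicalSpace M] [MPolyfold M] (w : M → P),
    ScSmooth w ↔ ScSmooth (a ∘ w) ∧ ScSmooth (b ∘ w)

/-- `P`, with the maps `a`, `b` and `c`, carries the natural M-polyfold structure of a subset of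
`A × B × C`: it has the subspace topology, and a map into `P` is sc-smooth exactly if its three
components are. -/
structure IsNaturalIn₃ {P A B C : Type u} [TopologicalSpace P] [MPolyfold P] [TopologicalSpace A]
    [MPolyfold A] [TopologicalSpace B] [MPolyfold B] [TopologicalSpace C] [MPolyfold C]
    (a : P → A) (b : P → B) (c : P → C) : Prop where
  embedding : IsEmbedding (fun p => (a p, b p, c p))
  scSmooth_iff : ∀ (M : Type u) [TopologicalSpace M] [MPolyfold M] (w : M → P),
    ScSmooth w ↔ ScSmooth (a ∘ w) ∧ ScSmooth (b ∘ w) ∧ ScSmooth (c ∘ w)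

/-! ## Groupoids -/

/-- A groupoid, presented by its set of objects, its set of morphisms and the structure maps
source `s`, target `t`, unit `u`, inverse `i` and multiplication `m h g = h ∘ g`, the latter being
defined on the fibered product `{(h, g) | s h = t g}`. -/
structure Grpd : Type (u + 1) where
  Obj : Type u
  Mor : Type u
  s : Mor → Obj
  t : Mor → Obj
  u : Obj → Mor
  i : Mor → Mor
  m : ∀ h g : Mor, s h = t g → Mor
  s_u : ∀ x, s (u x) = x
  t_u : ∀ x, t (u x) = x
  s_i : ∀ g, s (i g) = t g
  t_i : ∀ g, t (i g) = s g
  s_m : ∀ h g e, s (m h g e) = s g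
  t_m : ∀ h g e, t (m h g e) = t h
  m_u : ∀ g, m g (u (s g)) (t_u _).symm = g
  u_m : ∀ g, m (u (t g)) g (s_u _) = g
  m_assoc : ∀ k h g (e : s k = t h) (e' : s h = t g),
    m (m k h e) g ((s_m k h e).trans e') = m k (m h g e') (e.trans (t_m h g e').symm)
  m_i : ∀ g, m g (i g) (t_i g).symm = u (t g)
  i_m : ∀ g, m (i g) g (s_i g) = u (s g)

namespace Grpd

/-- The fibered product of composable pairs, with its two components `h` and `g`. -/
abbrev Composable (G : Grpd.{u}) : Type u := {p : G.Mor × G.Mor // G.s p.1 = G.t p.2}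

/-- Two objects are equivalent if there is a morphism between them. -/
def orbitSetoid (G : Grpd.{u}) : Setoid G.Obj where
  r x y := ∃ g : G.Mor, G.s g = x ∧ G.t g = y
  iseqv :=
    { refl := fun x => ⟨G.u x, G.s_u x, G.t_u x⟩
      symm := fun ⟨g, hs, ht⟩ => ⟨G.i g, (G.s_i g).trans ht, (G.t_i g).trans hs⟩
      trans := fun ⟨g, hs, ht⟩ ⟨h, hs', ht'⟩ =>
        ⟨G.m h g (hs'.trans ht.symm), (G.s_m _ _ _).trans hs, (G.t_m _ _ _).trans ht'⟩ }

/-- The orbit space. -/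
abbrev Orbit (G : Grpd.{u}) : Type u := Quotient G.orbitSetoid

/-- The isotropy group at `x`, as a set of morphisms. -/
def isotropy (G : Grpd.{u}) (x : G.Obj) : Set G.Mor := {g | G.s g = x ∧ G.t g = x}

/-- A functor between groupoids. -/
structure Functor (G H : Grpd.{u}) : Type u where
  obj : G.Obj → H.Obj
  mor : G.Mor → H.Mor
  s_mor : ∀ g, H.s (mor g) = obj (G.s g)
  t_mor : ∀ g, H.t (mor g) = obj (G.t g)
  mor_u : ∀ x, mor (G.u x) = H.u (obj x)
  mor_m : ∀ h g (e : G.s h = G.t g),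
    mor (G.m h g e) = H.m (mor h) (mor g) (by rw [s_mor, t_mor, e])

/-- The map induced by a functor on the orbit spaces. -/
def Functor.orbitMap {G H : Grpd.{u}} (F : Functor G H) : G.Orbit → H.Orbit :=
  Quotient.map F.obj (by
    rintro x y ⟨g, rfl, rfl⟩
    exact ⟨F.mor g, F.s_mor g, F.t_mor g⟩)

/-- `h ∘ φ ∘ g⁻¹`. -/
def conj (G : Grpd.{u}) (h φ g : G.Mor) (e : G.s h = G.t φ) (e' : G.s φ = G.s g) : G.Mor :=
  G.m (G.m h φ e) (G.i g) ((G.s_m _ _ _).trans (e'.trans (G.t_i g).symm))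

theorem m_congr (G : Grpd.{u}) {h h' g g' : G.Mor} (hh : h = h') (hg : g = g') (e e') :
    G.m h g e = G.m h' g' e' := by
  subst hh hg; rfl

theorem eq_i (G : Grpd.{u}) {h g : G.Mor} (e : G.s h = G.t g) (w : G.m h g e = G.u (G.s g)) :
    h = G.i g := by
  have e1 : G.s h = G.t (G.m g (G.i g) (G.t_i g).symm) := e.trans (G.t_m _ _ _).symm
  calc h = G.m h (G.u (G.s h)) (G.t_u _).symm := (G.m_u h).symm
    _ = G.m h (G.m g (G.i g) (G.t_i g).symm) e1 :=
        G.m_congr rfl ((congrArg G.u e).trans (G.m_i g).symm) _ _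
    _ = G.m (G.m h g e) (G.i g) ((G.s_m _ _ _).trans (G.t_i g).symm) :=
        (G.m_assoc h g (G.i g) e (G.t_i g).symm).symm
    _ = G.m (G.u (G.t (G.i g))) (G.i g) (G.s_u _) :=
        G.m_congr (w.trans (congrArg G.u (G.t_i g).symm)) rfl _ _
    _ = G.i g := G.u_m _

theorem i_u (G : Grpd.{u}) (x : G.Obj) : G.i (G.u x) = G.u x := by
  refine (G.eq_i ((G.s_u x).trans (G.t_u x).symm) ?_).symm
  calc _ = G.m (G.u x) (G.u (G.s (G.u x))) (G.t_u _).symm :=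
        G.m_congr rfl (congrArg G.u (G.s_u x).symm) _ _
    _ = G.u x := G.m_u _
    _ = _ := congrArg G.u (G.s_u x).symm

theorem i_i (G : Grpd.{u}) (g : G.Mor) : G.i (G.i g) = g :=
  (G.eq_i (G.t_i g).symm ((G.m_i g).trans (congrArg G.u (G.s_i g).symm))).symm

theorem i_mul (G : Grpd.{u}) (h g : G.Mor) (e : G.s h = G.t g) :
    G.i (G.m h g e) = G.m (G.i g) (G.i h) ((G.s_i g).trans (e.symm.trans (G.t_i h).symm)) := by
  have e0 : G.s (G.i g) = G.t (G.i h) := (G.s_i g).trans (e.symm.trans (G.t_i h).symm)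
  have e1 : G.s (G.m (G.i g) (G.i h) e0) = G.t (G.m h g e) :=
    (G.s_m _ _ _).trans ((G.s_i h).trans (G.t_m _ _ _).symm)
  have e2 : G.s (G.i h) = G.t (G.m h g e) := (G.s_i h).trans (G.t_m _ _ _).symm
  have e3 : G.s (G.m (G.i h) h (G.s_i h)) = G.t g := (G.s_m _ _ _).trans e
  refine (G.eq_i e1 ?_).symm
  calc _ = G.m (G.i g) (G.m (G.i h) (G.m h g e) e2) (e0.trans (G.t_m _ _ _).symm) :=
        G.m_assoc _ _ _ e0 e2
    _ = G.m (G.i g) g (G.s_i g) := G.m_congr rfl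
        (calc _ = G.m (G.m (G.i h) h (G.s_i h)) g e3 := (G.m_assoc _ _ _ (G.s_i h) e).symm
          _ = G.m (G.u (G.t g)) g (G.s_u _) :=
            G.m_congr ((G.i_m h).trans (congrArg G.u e)) rfl _ _
          _ = g := G.u_m g) _ _
    _ = G.u (G.s g) := G.i_m g
    _ = _ := congrArg G.u (G.s_m h g e).symm

theorem s_conj (G : Grpd.{u}) (h φ g : G.Mor) (e e') : G.s (G.conj h φ g e e') = G.t g :=
  (G.s_m _ _ _).trans (G.s_i g)

theorem t_conj (G : Grpd.{u}) (h φ g : G.Mor) (e e') : G.t (G.conj h φ g e e') = G.t h :=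
  (G.t_m _ _ _).trans (G.t_m _ _ _)

theorem conj_congr (G : Grpd.{u}) {h h' φ φ' g g' : G.Mor} (hh : h = h') (hφ : φ = φ')
    (hg : g = g') (e e' d d') : G.conj h φ g e e' = G.conj h' φ' g' d d' := by
  subst hh hφ hg; rfl

theorem conj_u (G : Grpd.{u}) (φ : G.Mor) {x y : G.Obj} (e : G.s (G.u x) = G.t φ)
    (e' : G.s φ = G.s (G.u y)) : G.conj (G.u x) φ (G.u y) e e' = φ := by
  obtain rfl : x = G.t φ := (G.s_u x).symm.trans e
  obtain rfl : y = G.s φ := (e'.trans (G.s_u y)).symm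
  calc _ = G.m φ (G.u (G.s φ)) (G.t_u _).symm := G.m_congr (G.u_m φ) (G.i_u _) _ _
    _ = φ := G.m_u φ

theorem conj_conj (G : Grpd.{u}) (h h' φ g g' : G.Mor) (e e' d d')
    (c : G.s h = G.t h') (c' : G.s g = G.t g') (b b') :
    G.conj h (G.conj h' φ g' e e') g d d' = G.conj (G.m h h' c) φ (G.m g g' c') b b' := by
  have a1 : G.s (G.m h' φ e) = G.t (G.i g') := e'.trans (G.t_i g').symm |> (G.s_m _ _ _).trans
  have a2 : G.s h = G.t (G.m h' φ e) := c.trans (G.t_m _ _ _).symm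
  have a3 : G.s (G.i g') = G.t (G.i g) := (G.s_i g').trans (c'.symm.trans (G.t_i g).symm)
  have a4 : G.s (G.m h (G.m h' φ e) a2) = G.t (G.i g') := (G.s_m _ _ _).trans a1
  calc G.conj h (G.conj h' φ g' e e') g d d'
      = G.m (G.m (G.m h (G.m h' φ e) a2) (G.i g') a4) (G.i g) ((G.s_m _ _ _).trans a3) :=
        G.m_congr (G.m_assoc h (G.m h' φ e) (G.i g') a2 a1).symm rfl _ _
    _ = G.m (G.m h (G.m h' φ e) a2) (G.m (G.i g') (G.i g) a3) (a4.trans (G.t_m _ _ _).symm) :=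
        G.m_assoc _ _ _ a4 a3
    _ = _ := G.m_congr (G.m_assoc h h' φ c e).symm (G.i_mul g g' c').symm _ _

theorem Functor.mor_i {G H : Grpd.{u}} (F : Functor G H) (g : G.Mor) :
    F.mor (G.i g) = H.i (F.mor g) := by
  refine H.eq_i ((F.s_mor _).trans ((congrArg F.obj (G.s_i g)).trans (F.t_mor g).symm)) ?_
  calc _ = F.mor (G.m (G.i g) g (G.s_i g)) := (F.mor_m _ _ _).symm
    _ = F.mor (G.u (G.s g)) := congrArg F.mor (G.i_m g)
    _ = H.u (F.obj (G.s g)) := F.mor_u _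
    _ = _ := congrArg H.u (F.s_mor g).symm

/-! ### The weak fibered product -/

variable {X Y Z : Grpd.{u}}

/-- Objects of the weak fibered product: triples `(x, φ, z)` with `φ : F(x) → G(z)`. -/
@[ext] structure WeakObj (F : Functor X Y) (G : Functor Z Y) : Type u where
  x : X.Obj
  φ : Y.Mor
  z : Z.Obj
  s_φ : Y.s φ = F.obj x
  t_φ : Y.t φ = G.obj z

/-- Morphisms of the weak fibered product: triples `(h, φ, k)` with `s(F(h)) = s(φ)` and
`t(φ) = s(G(k))`. -/
@[ext] structure WeakMor (F : Functor X Y) (G : Functor Z Y) : Type u where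
  h : X.Mor
  φ : Y.Mor
  k : Z.Mor
  s_h : Y.s (F.mor h) = Y.s φ
  t_φ : Y.t φ = Y.s (G.mor k)

namespace WeakMor

variable {F : Functor X Y} {G : Functor Z Y}

/-- The source `(s(h), φ, s(k))`. -/
def source (l : WeakMor F G) : WeakObj F G :=
  ⟨X.s l.h, l.φ, Z.s l.k, l.s_h.symm.trans (F.s_mor _), l.t_φ.trans (G.s_mor _)⟩

/-- The morphism `φ' = G(k) ∘ φ ∘ F(h)⁻¹`. -/
def φ' (l : WeakMor F G) : Y.Mor := Y.conj (G.mor l.k) l.φ (F.mor l.h) l.t_φ.symm l.s_h.symm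

/-- The target `(t(h), φ', t(k))`. -/
def target (l : WeakMor F G) : WeakObj F G :=
  ⟨X.t l.h, l.φ', Z.t l.k, (Y.s_conj _ _ _ _ _).trans (F.t_mor _),
    (Y.t_conj _ _ _ _ _).trans (G.t_mor _)⟩

/-- The unit morphism `(1_x, φ, 1_z)`. -/
def unit (a : WeakObj F G) : WeakMor F G :=
  ⟨X.u a.x, a.φ, Z.u a.z,
    (F.s_mor _).trans ((congrArg F.obj (X.s_u _)).trans a.s_φ.symm),
    a.t_φ.trans ((congrArg G.obj (Z.s_u _)).symm.trans (G.s_mor _).symm)⟩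

/-- The inverse `(h⁻¹, φ', k⁻¹)`. -/
def inv (l : WeakMor F G) : WeakMor F G :=
  ⟨X.i l.h, l.φ', Z.i l.k,
    (F.s_mor _).trans ((congrArg F.obj (X.s_i _)).trans
      ((F.t_mor _).symm.trans (Y.s_conj _ _ _ _ _).symm)),
    (Y.t_conj _ _ _ _ _).trans ((G.t_mor _).trans
      ((congrArg G.obj (Z.s_i _)).symm.trans (G.s_mor _).symm))⟩

/-- The composition `(h, φ, k) ∘ (h', ψ, k') = (h ∘ h', ψ, k ∘ k')`. -/
def comp (l l' : WeakMor F G) (e : l.source = l'.target) : WeakMor F G :=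
  ⟨X.m l.h l'.h (congrArg WeakObj.x e), l'.φ, Z.m l.k l'.k (congrArg WeakObj.z e),
    (F.s_mor _).trans ((congrArg F.obj (X.s_m _ _ _)).trans ((F.s_mor _).symm.trans l'.s_h)),
    l'.t_φ.trans ((G.s_mor _).trans ((congrArg G.obj (Z.s_m _ _ _)).symm.trans
      (G.s_mor _).symm))⟩

end WeakMor

/-- The weak fibered product `X ×_Y Z` of two functors `F : X → Y` and `G : Z → Y`. -/
def weakFiberedProduct (F : Functor X Y) (G : Functor Z Y) : Grpd.{u} where
  Obj := WeakObj F G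
  Mor := WeakMor F G
  s := WeakMor.source
  t := WeakMor.target
  u := WeakMor.unit
  i := WeakMor.inv
  m := WeakMor.comp
  s_u a := WeakObj.ext (X.s_u _) rfl (Z.s_u _)
  t_u a := WeakObj.ext (X.t_u _)
    ((Y.conj_congr (G.mor_u _) rfl (F.mor_u _) (WeakMor.unit a).t_φ.symm
      (WeakMor.unit a).s_h.symm ((Y.s_u _).trans a.t_φ.symm) (a.s_φ.trans (Y.s_u _).symm)).trans (Y.conj_u _ _ _))
    (Z.t_u _)
  s_i l := WeakObj.ext (X.s_i _) rfl (Z.s_i _)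
  t_i l := WeakObj.ext (X.t_i _) (by
    have e : Y.s (Y.i (G.mor l.k)) = Y.t (G.mor l.k) := Y.s_i _
    have e' : Y.s (Y.i (F.mor l.h)) = Y.t (F.mor l.h) := Y.s_i _
    have hG := Y.i_m (G.mor l.k)
    have hF := Y.i_m (F.mor l.h)
    calc l.inv.φ' = Y.conj (Y.i (G.mor l.k)) l.φ' (Y.i (F.mor l.h))
          (e.trans (Y.t_conj _ _ _ _ _).symm) ((Y.s_conj _ _ _ _ _).trans e'.symm) :=
          Y.conj_congr (G.mor_i _) rfl (F.mor_i _) _ _ _ _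
      _ = Y.conj (Y.m (Y.i (G.mor l.k)) (G.mor l.k) e) l.φ (Y.m (Y.i (F.mor l.h)) (F.mor l.h) e')
          ((Y.s_m _ _ _).trans l.t_φ.symm) (l.s_h.symm.trans (Y.s_m _ _ _).symm) :=
          Y.conj_conj _ _ _ _ _ _ _ _ _ _ _ _ _
      _ = Y.conj (Y.u (Y.s (G.mor l.k))) l.φ (Y.u (Y.s (F.mor l.h)))
          ((Y.s_u _).trans l.t_φ.symm) (l.s_h.symm.trans (Y.s_u _).symm) :=
          Y.conj_congr hG rfl hF _ _ _ _
      _ = l.φ := Y.conj_u _ _ _) (Z.t_i _)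
  s_m l l' e := WeakObj.ext (X.s_m _ _ _) rfl (Z.s_m _ _ _)
  t_m l l' e := WeakObj.ext (X.t_m _ _ _) (by
    have eX : X.s l.h = X.t l'.h := congrArg WeakObj.x e
    have eZ : Z.s l.k = Z.t l'.k := congrArg WeakObj.z e
    have eφ : l.φ = l'.φ' := congrArg WeakObj.φ e
    have cG : Y.s (G.mor l.k) = Y.t (G.mor l'.k) := by rw [G.s_mor, G.t_mor, eZ]
    have cF : Y.s (F.mor l.h) = Y.t (F.mor l'.h) := by rw [F.s_mor, F.t_mor, eX]
    calc (WeakMor.comp l l' e).φ'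
        = Y.conj (Y.m (G.mor l.k) (G.mor l'.k) cG) l'.φ (Y.m (F.mor l.h) (F.mor l'.h) cF)
          ((Y.s_m _ _ _).trans l'.t_φ.symm) (l'.s_h.symm.trans (Y.s_m _ _ _).symm) :=
          Y.conj_congr (G.mor_m _ _ _) rfl (F.mor_m _ _ _) _ _ _ _
      _ = Y.conj (G.mor l.k) l'.φ' (F.mor l.h) (cG.trans (Y.t_conj _ _ _ _ _).symm)
          ((Y.s_conj _ _ _ _ _).trans cF.symm) :=
          (Y.conj_conj _ _ _ _ _ _ _ _ _ _ _ _ _).symm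
      _ = l.φ' := Y.conj_congr rfl eφ.symm rfl _ _ _ _) (Z.t_m _ _ _)
  m_u l := WeakMor.ext (X.m_u _) rfl (Z.m_u _)
  u_m l := WeakMor.ext (X.u_m _) rfl (Z.u_m _)
  m_assoc k h g e e' := WeakMor.ext (X.m_assoc _ _ _ _ _) rfl (Z.m_assoc _ _ _ _ _)
  m_i l := WeakMor.ext (X.m_i _) rfl (Z.m_i _)
  i_m l := WeakMor.ext (X.i_m _) rfl (Z.i_m _)

/-- The projection functor `X ×_Y Z → Z`, `(x, φ, z) ↦ z`, `(h, φ, k) ↦ k`. -/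
def weakProj (F : Functor X Y) (G : Functor Z Y) : Functor (weakFiberedProduct F G) Z where
  obj := WeakObj.z
  mor := WeakMor.k
  s_mor _ := rfl
  t_mor _ := rfl
  mor_u _ := rfl
  mor_m _ _ _ := rfl

end Grpd

/-! ## Ep-groupoids -/

/-- The structure of an ep-groupoid on a groupoid `G`: M-polyfold structures on the object set and
on the morphism set such that the structure maps are sc-smooth, and which is étale and proper.
The multiplication is defined on the fibered product of composable pairs with its natural M-polyfold
structure. -/
@[ext] structure EpStructure (G : Grpd.{u}) : Type (u + 1) where
  [topObj : TopologicalSpace G.Obj]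
  [topMor : TopologicalSpace G.Mor]
  [polyObj : MPolyfold G.Obj]
  [polyMor : MPolyfold G.Mor]
  s_smooth : ScSmooth G.s
  t_smooth : ScSmooth G.t
  u_smooth : ScSmooth G.u
  i_smooth : ScSmooth G.i
  m_smooth : ∃ _ : MPolyfold G.Composable,
    IsNaturalIn₂ (fun p : G.Composable => p.1.1) (fun p : G.Composable => p.1.2) ∧
    ScSmooth (fun p : G.Composable => G.m p.1.1 p.1.2 p.2)
  s_surjective : Function.Surjective G.s
  t_surjective : Function.Surjective G.t
  s_etale : IsLocalScDiffeo G.s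
  t_etale : IsLocalScDiffeo G.t
  proper : ∀ x : G.Obj, ∃ V : Set G.Obj, IsOpen V ∧ x ∈ V ∧
    IsProperMap (fun g : {g : G.Mor // G.s g ∈ closure V} => G.t g)

/-- An ep-groupoid. -/
structure EpGroupoid : Type (u + 1) where
  toGrpd : Grpd.{u}
  str : EpStructure toGrpd

namespace EpGroupoid

instance (X : EpGroupoid.{u}) : TopologicalSpace X.toGrpd.Obj := X.str.topObj
instance (X : EpGroupoid.{u}) : TopologicalSpace X.toGrpd.Mor := X.str.topMor
instance (X : EpGroupoid.{u}) : MPolyfold X.toGrpd.Obj := X.str.polyObj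
instance (X : EpGroupoid.{u}) : MPolyfold X.toGrpd.Mor := X.str.polyMor

/-- The quotient topology on the orbit space. -/
instance (X : EpGroupoid.{u}) : TopologicalSpace X.toGrpd.Orbit :=
  inferInstanceAs (TopologicalSpace (Quotient X.toGrpd.orbitSetoid))

/-- The filtration `|X_m|` of the orbit space. -/
def orbitLevel (X : EpGroupoid.{u}) (m : ℕ) : Set X.toGrpd.Orbit :=
  Quotient.mk X.toGrpd.orbitSetoid '' polyLevel X.toGrpd.Obj m

variable {X Y : EpGroupoid.{u}}

/-- sc-smooth functors. -/
def IsScSmooth (F : Grpd.Functor X.toGrpd Y.toGrpd) : Prop :=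
  ScSmooth F.obj ∧ ScSmooth F.mor

/-- An sc-smooth functor is an equivalence if it is a local sc-diffeomorphism on objects and on
morphisms, induces an sc-homeomorphism of the orbit spaces (a homeomorphism preserving the
filtrations in both directions), and induces bijections of the isotropy groups. -/
structure IsEquivalence (F : Grpd.Functor X.toGrpd Y.toGrpd) : Prop where
  scSmooth : IsScSmooth F
  obj_local : IsLocalScDiffeo F.obj
  mor_local : IsLocalScDiffeo F.mor
  orbit_homeo : IsHomeomorph F.orbitMap
  orbit_level : ∀ m q, F.orbitMap q ∈ Y.orbitLevel m ↔ q ∈ X.orbitLevel m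
  isotropy_bij : ∀ x, BijOn F.mor (X.toGrpd.isotropy x) (Y.toGrpd.isotropy (F.obj x))

variable {Z : EpGroupoid.{u}}

/-- The ep-groupoid structure `𝓛` on the weak fibered product `X ×_Y Z` is the natural one: the
M-polyfold structures on its object set and on its morphism set are the natural ones of subsets of
`X × 𝐘 × Z` and of `𝐗 × 𝐘 × 𝐙`. -/
def IsNaturalWeak (F : Grpd.Functor X.toGrpd Y.toGrpd) (G : Grpd.Functor Z.toGrpd Y.toGrpd)
    (𝓛 : EpStructure (Grpd.weakFiberedProduct F G)) : Prop :=
  letI := 𝓛.topObj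
  letI := 𝓛.topMor
  letI := 𝓛.polyObj
  letI := 𝓛.polyMor
  IsNaturalIn₃ (P := (Grpd.weakFiberedProduct F G).Obj) (A := X.toGrpd.Obj) (B := Y.toGrpd.Mor)
    (C := Z.toGrpd.Obj) Grpd.WeakObj.x Grpd.WeakObj.φ Grpd.WeakObj.z ∧
  IsNaturalIn₃ (P := (Grpd.weakFiberedProduct F G).Mor) (A := X.toGrpd.Mor) (B := Y.toGrpd.Mor)
    (C := Z.toGrpd.Mor) Grpd.WeakMor.h Grpd.WeakMor.φ Grpd.WeakMor.k

end EpGroupoid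

end ScGeom

/-!
The equivalence `F` and the source and target maps of an ep-groupoid are local sc-diffeomorphisms.
Hence an object `(x, φ, z)` of the weak fibered product is, near a given one, determined by `z`:
the morphism `φ` is recovered from `t(φ) = G(z)`, and `x` is recovered from `F(x) = s(φ)`. In the
same way `(h, φ, k)` is locally determined by `k`. So the projections to `Z` are local
homeomorphisms for the subspace topologies, and the M-polyfold structures are pulled back along them
(`exists_mPolyfold_isLocalScDiffeo`, `exists_isNaturalIn₃`). No products of M-polyfolds are needed.

That the pulled back structure is natural, and that all structure maps are sc-smooth, comes from one
principle: a continuous lift of an sc-smooth map through a local sc-diffeomorphism is sc-smooth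
(`IsLocalScDiffeo.scSmooth_of_comp`). Étaleness of source and target is inherited from `Z`, since
the projection intertwines them (`IsLocalScDiffeo.of_comp`). Properness is inherited from `X` and `Z`,
because `φ` is recovered from `h`, `k` and the target (`isProperMap_weak_target`). Uniqueness holds
as the identity is sc-smooth between any two natural structures, and a maximal atlas is determined
by the sc-smoothness of the identity (`MPolyfold.eq_of_scSmooth_id`).

The projection is an equivalence because `F` is full and faithful: injectivity on orbit spaces and
bijectivity on isotropy groups for `F` yield the same for the projection, and a bijective orbit map
of a functor that is a local sc-diffeomorphism is a homeomorphism. Levels are respected since local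
sc-diffeomorphisms preserve and reflect the filtration.

The analytic foundation consists of two facts about maps of class sc^k. They compose (`IsSc.comp`);
the chain rule behind this uses the compactness of the inclusions
(`hasFDerivWithinAt_comp_of_isCompactOperator`). And they can be glued (`IsSc.of_locally`), since
derivatives are unique on relatively open subsets of partial quadrants and `E₁` is dense in `E₀`.
-/

namespace ScGeom

/-! ### The chain rule for sc-smooth maps -/

section ChainRule

variable {E₁ E₀ F₁ F₀ H₀ : Type*}
  [NormedAddCommGroup E₁] [NormedAddCommGroup E₀] [NormedAddCommGroup F₁]
  [NormedAddCommGroup F₀] [NormedAddCommGroup H₀]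

/-- A family of operators that is only jointly continuous, `(y, v) ↦ B y v`, is nevertheless close
to `B y₀` uniformly in `v` as long as `v` stays in a compact set. -/
theorem exists_delta_of_isCompact {V : Set F₁} {B : F₁ → F₀ → H₀}
    (hB : ContinuousOn (fun p : F₁ × F₀ => B p.1 p.2) (V ×ˢ univ)) {y₀ : F₁} (hy₀ : y₀ ∈ V)
    {K : Set F₀} (hK : IsCompact K) {ε : ℝ} (hε : 0 < ε) :
    ∃ δ > 0, ∀ v ∈ K, ∀ y ∈ V, ‖y - y₀‖ < δ → ∀ w, ‖w - v‖ < δ → ‖B y w - B y₀ v‖ < ε := by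
  refine hK.induction_on (p := fun s => ∃ δ > 0, ∀ v ∈ s, ∀ y ∈ V, ‖y - y₀‖ < δ →
    ∀ w, ‖w - v‖ < δ → ‖B y w - B y₀ v‖ < ε) ⟨1, one_pos, by simp⟩ ?_ ?_ ?_
  · rintro s t hst ⟨δ, hδ, h⟩
    exact ⟨δ, hδ, fun v hv => h v (hst hv)⟩
  · rintro s t ⟨δ, hδ, h⟩ ⟨δ', hδ', h'⟩
    refine ⟨min δ δ', lt_min hδ hδ', ?_⟩
    rintro v (hv | hv) y hy hyd w hw
    · exact h v hv y hy (hyd.trans_le (min_le_left _ _)) w (hw.trans_le (min_le_left _ _))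
    · exact h' v hv y hy (hyd.trans_le (min_le_right _ _)) w (hw.trans_le (min_le_right _ _))
  · intro v _
    have hc := hB (y₀, v) ⟨hy₀, mem_univ _⟩
    rw [Metric.continuousWithinAt_iff] at hc
    obtain ⟨δ, hδ, h⟩ := hc (ε / 2) (half_pos hε)
    refine ⟨Metric.ball v (δ / 2),
      mem_nhdsWithin_of_mem_nhds (Metric.ball_mem_nhds _ (half_pos hδ)), δ / 2, half_pos hδ, ?_⟩
    intro v' hv' y hy hyd w hw
    rw [mem_ball_iff_norm] at hv'
    have hwv : ‖w - v‖ < δ := by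
      have := norm_add_le (w - v') (v' - v)
      rw [sub_add_sub_cancel] at this
      linarith
    have h1 : dist (B y w) (B y₀ v) < ε / 2 := by
      refine @h (y, w) ⟨hy, mem_univ _⟩ ?_
      rw [Prod.dist_eq, max_lt_iff, dist_eq_norm, dist_eq_norm]
      exact ⟨by linarith, hwv⟩
    have h2 : dist (B y₀ v') (B y₀ v) < ε / 2 := by
      refine @h (y₀, v') ⟨hy₀, mem_univ _⟩ ?_
      rw [Prod.dist_eq, max_lt_iff, dist_eq_norm, dist_eq_norm]
      exact ⟨by simpa using hδ, by linarith⟩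
    rw [← dist_eq_norm]
    linarith [dist_triangle_right (B y w) (B y₀ v') (B y₀ v)]

variable [NormedSpace ℝ E₁] [NormedSpace ℝ E₀] [NormedSpace ℝ F₁] [NormedSpace ℝ F₀]
  [NormedSpace ℝ H₀]

/-- The chain rule of sc-calculus. The inner map is differentiable only as a map `E₁ → F₀`, and
merely continuous as a map `E₁ → F₁`, while the outer map is differentiable as a map `F₁ → H₀`.
Compactness of the inclusion `E₁ → E₀` makes up for the missing derivative. -/
theorem hasFDerivWithinAt_comp_of_isCompactOperator {iE : E₁ →L[ℝ] E₀} {iF : F₁ →L[ℝ] F₀}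
    (hiE : IsCompactOperator iE) {U : Set E₁} {V O C : Set F₁} (hO : IsOpen O) (hC : Convex ℝ C)
    (hV : V = O ∩ C) {f₁ : E₁ → F₁} {f₀ : E₁ → F₀} {x : E₁} (hx : x ∈ U) (hUV : MapsTo f₁ U V)
    (hf₁ : ContinuousWithinAt f₁ U x) (hf₀ : ∀ y ∈ U, iF (f₁ y) = f₀ y)
    {A : E₀ →L[ℝ] F₀} (hA : HasFDerivWithinAt f₀ (A.comp iE) U x)
    {g : F₁ → H₀} {B : F₁ → F₀ → H₀}
    (hB : ContinuousOn (fun p : F₁ × F₀ => B p.1 p.2) (V ×ˢ univ))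
    (hg : ∀ y ∈ V, ∃ B' : F₀ →L[ℝ] H₀, (∀ h, B y h = B' h) ∧
      HasFDerivWithinAt g (B'.comp iF) V y)
    {B₀ : F₀ →L[ℝ] H₀} (hB₀ : ∀ h, B (f₁ x) h = B₀ h) :
    HasFDerivWithinAt (fun y => g (f₁ y)) ((B₀.comp A).comp iE) U x := by
  set y₀ := f₁ x
  have hy₀ : y₀ ∈ V := hUV hx
  rw [hasFDerivWithinAt_iff_isLittleO, Asymptotics.isLittleO_iff]
  intro ε hε
  obtain ⟨K, hK, hKsub⟩ : ∃ K, IsCompact K ∧ ∀ h : E₁, ‖h‖ ≤ 1 → A (iE h) ∈ K :=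
    ⟨_, (hiE.isCompact_closure_image_closedBall 1).image A.continuous,
      fun h hh => mem_image_of_mem A (subset_closure (mem_image_of_mem iE (by simpa using hh)))⟩
  obtain ⟨δ, hδ, hunif⟩ := exists_delta_of_isCompact hB hy₀ hK hε
  have hOδ : O ∩ Metric.ball y₀ δ ∈ 𝓝 y₀ :=
    Filter.inter_mem (hO.mem_nhds (hV ▸ hy₀).1) (Metric.ball_mem_nhds _ hδ)
  obtain ⟨ρ, hρ, hball⟩ := Metric.mem_nhds_iff.1 hOδ
  rw [hasFDerivWithinAt_iff_isLittleO, Asymptotics.isLittleO_iff] at hA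
  filter_upwards [hA (half_pos hδ), hf₁ (Metric.ball_mem_nhds _ hρ), self_mem_nhdsWithin]
    with y hyA hyρ hyU
  rcases eq_or_ne y x with rfl | hne
  · simp
  have hr : 0 < ‖y - x‖ := norm_pos_iff.2 (sub_ne_zero.2 hne)
  set r := ‖y - x‖
  set k := f₁ y - y₀
  -- `w` is the difference quotient of the inner map and `v` its derivative in the same direction;
  -- `v` ranges in a compact set and `w - v` tends to `0`.
  set v := A (iE (r⁻¹ • (y - x)))
  set w := r⁻¹ • iF k
  have hv : v ∈ K := hKsub _ (by
    rw [norm_smul, norm_inv, Real.norm_of_nonneg hr.le]; exact (inv_mul_cancel₀ hr.ne').le)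
  have hrv : A (iE (y - x)) = r • v := by
    simp only [v, map_smul, smul_smul, mul_inv_cancel₀ hr.ne', one_smul]
  have hrw : iF k = r • w := by simp only [w, smul_smul, mul_inv_cancel₀ hr.ne', one_smul]
  have hwv : ‖w - v‖ < δ := by
    have h1 : r • (w - v) = f₀ y - f₀ x - (A.comp iE) (y - x) := by
      rw [smul_sub, ← hrw, ← hrv, map_sub, hf₀ y hyU, hf₀ x hx]; rfl
    have h2 : r * ‖w - v‖ ≤ δ / 2 * r := by
      rw [← Real.norm_of_nonneg hr.le, ← norm_smul, h1, Real.norm_of_nonneg hr.le]; exact hyA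
    have h3 : ‖w - v‖ ≤ δ / 2 := by
      rw [mul_comm] at h2; exact le_of_mul_le_mul_right h2 hr
    linarith
  have hseg : ∀ τ ∈ Icc (0 : ℝ) 1, y₀ + τ • k ∈ V ∧ ‖y₀ + τ • k - y₀‖ < δ := by
    intro τ hτ
    have hb : y₀ + τ • k ∈ Metric.ball y₀ ρ := by
      rw [mem_ball_iff_norm, add_sub_cancel_left, norm_smul, Real.norm_of_nonneg hτ.1]
      have : ‖k‖ < ρ := mem_ball_iff_norm.1 hyρ
      exact (mul_le_of_le_one_left (norm_nonneg _) hτ.2).trans_lt this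
    have hb' := hball hb
    refine ⟨?_, by simpa [mem_ball_iff_norm] using hb'.2⟩
    rw [hV]
    exact ⟨hb'.1, hC.add_smul_sub_mem (hV ▸ hy₀).2 (hV ▸ hUV hyU).2 hτ⟩
  -- The mean value inequality is applied along the segment from `f₁ x` to `f₁ y`, after
  -- subtracting the expected linear term.
  have hder : ∀ τ ∈ Icc (0 : ℝ) 1, HasDerivWithinAt
      (fun τ : ℝ => g (y₀ + τ • k) - τ • B₀ (r • v))
      (B (y₀ + τ • k) (iF k) - B₀ (r • v)) (Icc 0 1) τ := by
    intro τ hτ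
    obtain ⟨B', hB', hgd⟩ := hg _ (hseg τ hτ).1
    have hl : HasDerivWithinAt (fun τ : ℝ => y₀ + τ • k) k (Icc 0 1) τ := by
      simpa using ((hasDerivWithinAt_id τ (Icc (0 : ℝ) 1)).smul_const k).const_add y₀
    have h1 := hgd.comp_hasDerivWithinAt τ hl (fun σ hσ => (hseg σ hσ).1)
    have h2 : HasDerivWithinAt (fun τ : ℝ => τ • B₀ (r • v)) (B₀ (r • v)) (Icc 0 1) τ := by
      simpa using (hasDerivWithinAt_id τ (Icc (0 : ℝ) 1)).smul_const (B₀ (r • v))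
    rw [hB']
    exact h1.sub h2
  have hbound : ∀ τ ∈ Ico (0 : ℝ) 1, ‖B (y₀ + τ • k) (iF k) - B₀ (r • v)‖ ≤ ε * r := by
    intro τ hτ
    obtain ⟨hmem, hlt⟩ := hseg τ (Ico_subset_Icc_self hτ)
    obtain ⟨B', hB', -⟩ := hg _ hmem
    have := hunif v hv _ hmem hlt w hwv
    rw [hB', hB₀] at this
    have e : B' (r • w) - B₀ (r • v) = r • (B' w - B₀ v) := by
      rw [smul_sub, map_smul B₀]; exact congrArg (· - _) (map_smul B' r w)
    rw [hB', hrw, e, norm_smul, Real.norm_of_nonneg hr.le, mul_comm]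
    exact mul_le_mul_of_nonneg_right this.le hr.le
  have hfin := norm_image_sub_le_of_norm_deriv_le_segment_01' hder hbound
  have hk : y₀ + k = f₁ y := by simp [k]
  simp only [one_smul, zero_smul, add_zero, sub_zero, hk] at hfin
  have hgoal : g (f₁ y) - g (f₁ x) - ((B₀.comp A).comp iE) (y - x)
      = g (f₁ y) - B₀ (r • v) - g y₀ := by
    rw [← hrv]; simp only [ContinuousLinearMap.comp_apply]; abel
  rw [hgoal]
  exact hfin

end ChainRule

/-! ### Maps of class sc^k -/

variable {E F H : ScBanach.{u}}

theorem ScBanach.toZero_prod (E F : ScBanach.{u}) (m : ℕ) (p : (E.prod F).lvl m) :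
    (E.prod F).toZero m p = (E.toZero m p.1, F.toZero m p.2) := by
  induction m with
  | zero => rfl
  | succ k ih => exact ih ((E.prod F).incl k p)

theorem ScBanach.incl_toZero_shift (E : ScBanach.{u}) (m : ℕ) (x : E.shift.lvl m) :
    E.incl 0 (E.shift.toZero m x) = E.toZero (m + 1) x := by
  induction m with
  | zero => rfl
  | succ k ih => exact ih (E.shift.incl k x)

theorem ScBanach.denseRange_incl_zero (E : ScBanach.{u}) : DenseRange (E.incl 0) :=
  (E.dense_isSmoothPt 0).mono fun x hx => by
    obtain ⟨y, hy⟩ := hx 1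
    exact ⟨y, hy⟩

theorem mem_levelSet_tangentSet {U : Set (E.lvl 0)} {m : ℕ} {p : E.tangent.lvl m} :
    p ∈ levelSet (tangentSet U) m ↔ p.1 ∈ levelSet U (m + 1) := by
  have h := ScBanach.toZero_prod E.shift E m p
  have h' := ScBanach.incl_toZero_shift E m p.1
  change E.incl 0 (E.tangent.toZero m p).1 ∈ U ↔ E.toZero (m + 1) p.1 ∈ U
  rw [← h', show (E.tangent.toZero m p).1 = E.shift.toZero m p.1 from congrArg Prod.fst h]

theorem incl_mem_levelSet {U : Set (E.lvl 0)} {m : ℕ} {x : E.lvl (m + 1)} :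
    E.incl m x ∈ levelSet U m ↔ x ∈ levelSet U (m + 1) := Iff.rfl

theorem IsSc0.toZero_eq {U : Set (E.lvl 0)} {f : ∀ m, E.lvl m → F.lvl m} (hf : IsSc0 U f) :
    ∀ (m : ℕ), ∀ x ∈ levelSet U m, F.toZero m (f m x) = f 0 (E.toZero m x)
  | 0, _, _ => rfl
  | m + 1, x, hx => by
    rw [ScBanach.toZero_succ, hf.2 m x hx, hf.toZero_eq m _ (incl_mem_levelSet.2 hx),
      ScBanach.toZero_succ]

theorem IsSc0.mapsTo {U : Set (E.lvl 0)} {V : Set (F.lvl 0)} {f : ∀ m, E.lvl m → F.lvl m}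
    (hf : IsSc0 U f) (h : MapsTo (f 0) U V) (m : ℕ) :
    MapsTo (f m) (levelSet U m) (levelSet V m) := fun x hx => by
  change F.toZero m (f m x) ∈ V
  rw [hf.toZero_eq m x hx]
  exact h hx

theorem IsSc.isSc0 {k : ℕ} {U : Set (E.lvl 0)} {f : ∀ m, E.lvl m → F.lvl m}
    (h : IsSc k E F U f) : IsSc0 U f := by
  cases k with
  | zero => exact h
  | succ k => exact h.1

theorem IsSc.mono : ∀ {k : ℕ} {E F : ScBanach.{u}} {U U' : Set (E.lvl 0)}
    {f : ∀ m, E.lvl m → F.lvl m}, IsSc k E F U f → U' ⊆ U → IsSc k E F U' f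
  | 0, _, _, _, _, _, h, hU =>
    ⟨fun m => (h.1 m).mono (preimage_mono hU), fun m x hx => h.2 m x (hU hx)⟩
  | k + 1, _, _, _, _, _, ⟨h0, D, hD, hT⟩, hU =>
    ⟨⟨fun m => (h0.1 m).mono (preimage_mono hU), fun m x hx => h0.2 m x (hU hx)⟩, D,
      fun x hx => by
        obtain ⟨A, hA, hA'⟩ := hD x (hU hx)
        exact ⟨A, hA, hA'.mono (preimage_mono hU)⟩,
      hT.mono fun _ hp => hU hp⟩

theorem IsSc.congr : ∀ {k : ℕ} {E F : ScBanach.{u}} {U : Set (E.lvl 0)}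
    {f g : ∀ m, E.lvl m → F.lvl m}, IsSc k E F U f → (∀ m, EqOn (g m) (f m) (levelSet U m)) →
    IsSc k E F U g := by
  have h0 : ∀ {E F : ScBanach.{u}} {U : Set (E.lvl 0)} {f g : ∀ m, E.lvl m → F.lvl m},
      IsSc0 U f → (∀ m, EqOn (g m) (f m) (levelSet U m)) → IsSc0 U g := by
    intro E F U f g hf h
    refine ⟨fun m => (hf.1 m).congr (h m), fun m x hx => ?_⟩
    rw [h (m + 1) hx, hf.2 m x hx, h m (incl_mem_levelSet.2 hx)]
  intro k
  induction k with
  | zero => exact fun hf h => h0 hf h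
  | succ k ih =>
    rintro E F U f g ⟨hf, D, hD, hT⟩ h
    refine ⟨h0 hf h, D, fun x hx => ?_, ih hT fun m p hp => ?_⟩
    · obtain ⟨A, hA, hA'⟩ := hD x hx
      exact ⟨A, hA, hA'.congr (fun y hy => h 0 (incl_mem_levelSet.2 hy))
        (h 0 (incl_mem_levelSet.2 hx))⟩
    · exact Prod.ext (h (m + 1) (mem_levelSet_tangentSet.1 hp)) rfl

/-- The domains on which sc-calculus behaves well: relatively open subsets of convex sets whose
levels admit unique derivatives. Relatively open subsets of partial quadrants are of this kind, and
so are the tangents of such sets. -/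
structure IsScDomain (U : Set (E.lvl 0)) : Prop where
  relOpen : ∃ O C : Set (E.lvl 0), IsOpen O ∧ Convex ℝ C ∧ U = O ∩ C
  uniqueDiffOn : ∀ m, UniqueDiffOn ℝ (levelSet U m)

theorem IsScDomain.tangentSet {U : Set (E.lvl 0)} (hU : IsScDomain U) :
    IsScDomain (E := E.tangent) (tangentSet U) := by
  refine ⟨?_, fun m => ?_⟩
  · obtain ⟨O, C, hO, hC, rfl⟩ := hU.relOpen
    let l : E.tangent.lvl 0 →L[ℝ] E.lvl 0 := (E.incl 0).comp (ContinuousLinearMap.fst ℝ _ _)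
    exact ⟨l ⁻¹' O, l ⁻¹' C, hO.preimage l.continuous,
      hC.is_linear_preimage l.toLinearMap.isLinear, rfl⟩
  · have : levelSet (E := E.tangent) (ScGeom.tangentSet U) m = levelSet U (m + 1) ×ˢ univ := by
      ext p
      rw [mem_levelSet_tangentSet]
      simp
    rw [this]
    exact (hU.uniqueDiffOn (m + 1)).prod uniqueDiffOn_univ

theorem IsScDomain.inter {U O : Set (E.lvl 0)} (hU : IsScDomain U) (hO : IsOpen O) :
    IsScDomain (U ∩ O) := by
  refine ⟨?_, fun m => (hU.uniqueDiffOn m).inter (hO.preimage (E.toZero m).continuous)⟩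
  obtain ⟨O', C, hO', hC, rfl⟩ := hU.relOpen
  exact ⟨O' ∩ O, C, hO'.inter hO, hC, inter_right_comm _ _ _⟩

/-- The composition of maps of class sc^k is of class sc^k. -/
theorem IsSc.comp : ∀ {k : ℕ} {E F H : ScBanach.{u}} {U : Set (E.lvl 0)} {V : Set (F.lvl 0)}
    {f : ∀ m, E.lvl m → F.lvl m} {g : ∀ m, F.lvl m → H.lvl m}, IsScDomain V →
    IsSc k F H V g → IsSc k E F U f → MapsTo (f 0) U V →
    IsSc k E H U (fun m x => g m (f m x)) := by
  have h0 : ∀ {E F H : ScBanach.{u}} {U : Set (E.lvl 0)} {V : Set (F.lvl 0)}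
      {f : ∀ m, E.lvl m → F.lvl m} {g : ∀ m, F.lvl m → H.lvl m}, IsSc0 V g → IsSc0 U f →
      MapsTo (f 0) U V → IsSc0 U (fun m x => g m (f m x)) := by
    intro E F H U V f g hg hf hUV
    refine ⟨fun m => (hg.1 m).comp (hf.1 m) (hf.mapsTo hUV m), fun m x hx => ?_⟩
    rw [hg.2 m _ (hf.mapsTo hUV (m + 1) hx), hf.2 m x hx]
  intro k
  induction k with
  | zero => exact fun _ hg hf h => h0 hg hf h
  | succ k ih =>
    rintro E F H U V f g hV ⟨hg, B, hB, hTg⟩ ⟨hf, A, hA, hTf⟩ hUV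
    have hUV₁ : MapsTo (f 1) (levelSet U 1) (levelSet V 1) := hf.mapsTo hUV 1
    refine ⟨h0 hg hf hUV, fun m x h => B m (f (m + 1) x) (A m x h), fun x hx => ?_, ?_⟩
    · obtain ⟨A', hA', hfd⟩ := hA x hx
      obtain ⟨B', hB', -⟩ := hB _ (hUV₁ hx)
      refine ⟨B'.comp A', fun h => (hB' _).trans (congrArg B' (hA' h)), ?_⟩
      obtain ⟨O, C, hO, hC, rfl⟩ := hV.relOpen
      have hBc : ContinuousOn (fun p : F.lvl 1 × F.lvl 0 => B 0 p.1 p.2)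
          (levelSet (O ∩ C) 1 ×ˢ univ) := by
        have hc : ContinuousOn (fun p : F.lvl 1 × F.lvl 0 => (g 1 p.1, B 0 p.1 p.2))
          (levelSet (E := F.tangent) (tangentSet (O ∩ C)) 0) := hTg.isSc0.1 0
        exact (continuous_snd.comp_continuousOn hc).mono fun p hp => hp.1
      have hg' : ∀ y ∈ levelSet U 1, F.incl 0 (f 1 y) = f 0 (E.incl 0 y) := hf.2 0
      refine (hasFDerivWithinAt_comp_of_isCompactOperator (E.incl_compact 0)
        (hO.preimage (F.incl 0).continuous)
        (hC.is_linear_preimage (F.incl 0).toLinearMap.isLinear) (V := levelSet (O ∩ C) 1) rfl hx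
        hUV₁ (hf.1 1 x hx) hg' hfd hBc hB hB').congr (fun y hy => ?_) ?_
      · exact congrArg (g 0) (hg' y hy).symm
      · exact congrArg (g 0) (hg' x hx).symm
    · refine ih hV.tangentSet hTg hTf fun p hp => ?_
      change F.incl 0 (f 1 p.1) ∈ V
      rw [hf.2 0 p.1 hp]
      exact hUV hp

/-- The datum `D` in the definition of class sc^(k+1) is determined by the map. -/
theorem eq_of_hasFDerivWithinAt_comp_incl {U : Set (E.lvl 0)} (hU : IsScDomain U)
    {f : E.lvl 1 → F.lvl 0} {x : E.lvl 1} (hx : x ∈ levelSet U 1) {A B : E.lvl 0 →L[ℝ] F.lvl 0}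
    (hA : HasFDerivWithinAt f (A.comp (E.incl 0)) (levelSet U 1) x)
    (hB : HasFDerivWithinAt f (B.comp (E.incl 0)) (levelSet U 1) x) : A = B := by
  have h := (hU.uniqueDiffOn 1 x hx).eq hA hB
  refine ContinuousLinearMap.coeFn_injective
    (E.denseRange_incl_zero.equalizer A.continuous B.continuous ?_)
  exact funext fun y => congrArg (fun l : E.lvl 1 →L[ℝ] F.lvl 0 => l y) h

/-- Being of class sc^k is a local property: the local data `D` agree where they overlap, since they
are determined by the map, and so they glue. -/
theorem IsSc.of_locally : ∀ {k : ℕ} {E F : ScBanach.{u}} {U : Set (E.lvl 0)}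
    {f : ∀ m, E.lvl m → F.lvl m}, IsScDomain U →
    (∀ x ∈ U, ∃ O, IsOpen O ∧ x ∈ O ∧ IsSc k E F (U ∩ O) f) → IsSc k E F U f := by
  have h0 : ∀ {E F : ScBanach.{u}} {U : Set (E.lvl 0)} {f : ∀ m, E.lvl m → F.lvl m},
      (∀ x ∈ U, ∃ O, IsOpen O ∧ x ∈ O ∧ IsSc0 (U ∩ O) f) → IsSc0 U f := by
    intro E F U f h
    refine ⟨fun m x hx => ?_, fun m x hx => ?_⟩
    · obtain ⟨O, hO, hxO, hf⟩ := h _ hx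
      refine ((hf.1 m) x ⟨hx, hxO⟩).mono_of_mem_nhdsWithin ?_
      exact Filter.inter_mem self_mem_nhdsWithin
        (mem_nhdsWithin_of_mem_nhds ((hO.preimage (E.toZero m).continuous).mem_nhds hxO))
    · obtain ⟨O, hO, hxO, hf⟩ := h _ hx
      exact hf.2 m x ⟨hx, hxO⟩
  intro k
  induction k with
  | zero => exact fun _ h => h0 h
  | succ k ih =>
    intro E F U f hU h
    choose! O hO hxO hf D hD hT using h
    -- On all levels the datum chosen for `x` agrees with the one chosen for the base point itself;
    -- as inclusions are injective, it suffices to compare them on level `0`.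
    have key : ∀ x ∈ U, ∀ m, ∀ y ∈ levelSet (U ∩ O x) (m + 1), ∀ v,
        D (E.toZero (m + 1) y) m y v = D x m y v := by
      intro x hx m y hy v
      set z := E.toZero (m + 1) y
      have hz : z ∈ U := hy.1
      have hyz : y ∈ levelSet (U ∩ O z) (m + 1) := ⟨hz, hxO z hz⟩
      apply F.toZero_injective m
      have e : ∀ w ∈ U, y ∈ levelSet (U ∩ O w) (m + 1) →
          F.toZero m (D w m y v) = D w 0 (E.shift.toZero m y) (E.toZero m v) := by
        intro w hw hyw
        have := (hT w hw).isSc0.toZero_eq m (y, v)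
          (mem_levelSet_tangentSet (E := E).2 hyw)
        have h2 := congrArg Prod.snd
          ((ScBanach.toZero_prod F.shift F m _).symm.trans this)
        refine h2.trans ?_
        have h3 := ScBanach.toZero_prod E.shift E m (y, v)
        change D w 0 (E.tangent.toZero m (y, v)).1 (E.tangent.toZero m (y, v)).2 = _
        rw [show E.tangent.toZero m (y, v) = _ from h3]
      rw [e x hx hy, e z hz hyz]
      have hm : ∀ w, y ∈ levelSet (U ∩ O w) (m + 1) →
          E.shift.toZero m y ∈ levelSet (U ∩ O w) 1 := by
        intro w hw
        change E.incl 0 (E.shift.toZero m y) ∈ U ∩ O w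
        rw [ScBanach.incl_toZero_shift]
        exact hw
      obtain ⟨A, hA, hA'⟩ := hD x hx _ (hm x hy)
      obtain ⟨B, hB, hB'⟩ := hD z hz _ (hm z hyz)
      have hsub : U ∩ O x ∩ O z ⊆ U ∩ O z := fun p hp => ⟨hp.1.1, hp.2⟩
      have := eq_of_hasFDerivWithinAt_comp_incl ((hU.inter (hO x hx)).inter (hO z hz))
        ⟨hm x hy, (hm z hyz).2⟩ (hA'.mono (preimage_mono inter_subset_left))
        (hB'.mono (preimage_mono hsub))
      rw [hA, hB, this]
    refine ⟨h0 fun x hx => ⟨O x, hO x hx, hxO x hx, hf x hx⟩,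
      fun m y v => D (E.toZero (m + 1) y) m y v, fun y hy => ?_, ih hU.tangentSet fun p hp => ?_⟩
    · have hz : E.toZero 1 y ∈ U := hy
      obtain ⟨A, hA, hA'⟩ := hD _ hz y ⟨hy, hxO _ hz⟩
      refine ⟨A, hA, hA'.mono_of_mem_nhdsWithin ?_⟩
      exact Filter.inter_mem self_mem_nhdsWithin
        (mem_nhdsWithin_of_mem_nhds (((hO _ hz).preimage (E.incl 0).continuous).mem_nhds
          (hxO _ hz)))
    · have hx : E.incl 0 p.1 ∈ U := hp
      refine ⟨{q | E.incl 0 q.1 ∈ O (E.incl 0 p.1)},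
        (hO _ hx).preimage ((E.incl 0).continuous.comp continuous_fst), hxO _ hx, ?_⟩
      exact (hT _ hx).congr fun m q hq => Prod.ext rfl
        (key _ hx m q.1 (mem_levelSet_tangentSet.1 hq) q.2)

/-! ### sc-smooth maps between subsets of sc-Banach spaces -/

theorem ScSmoothOn.mono {U U' : Set (E.lvl 0)} {f : E.lvl 0 → F.lvl 0} (h : ScSmoothOn U f)
    (hU : U' ⊆ U) : ScSmoothOn U' f := by
  obtain ⟨fl, h0, hk⟩ := h
  exact ⟨fl, h0.mono hU, fun k => (hk k).mono hU⟩

theorem ScSmoothOn.congr {U : Set (E.lvl 0)} {f g : E.lvl 0 → F.lvl 0} (h : ScSmoothOn U f)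
    (hfg : EqOn f g U) : ScSmoothOn U g := by
  obtain ⟨fl, h0, hk⟩ := h
  exact ⟨fl, h0.trans hfg, hk⟩

theorem ScSmoothOn.continuousOn {U : Set (E.lvl 0)} {f : E.lvl 0 → F.lvl 0}
    (h : ScSmoothOn U f) : ContinuousOn f U := by
  obtain ⟨fl, h0, hk⟩ := h
  exact ((hk 0).1 0).congr fun x hx => (h0 hx).symm

theorem ScSmoothOn.mem_range_toZero {U : Set (E.lvl 0)} {f : E.lvl 0 → F.lvl 0}
    (h : ScSmoothOn U f) {m : ℕ} {x : E.lvl 0} (hx : x ∈ U) (hxm : x ∈ range (E.toZero m)) :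
    f x ∈ range (F.toZero m) := by
  obtain ⟨fl, h0, hk⟩ := h
  obtain ⟨y, rfl⟩ := hxm
  exact ⟨fl m y, ((hk 0).isSc0.toZero_eq m y hx).trans (h0 hx)⟩

theorem ScSmoothOn.comp {U : Set (E.lvl 0)} {V : Set (F.lvl 0)} {f : E.lvl 0 → F.lvl 0}
    {g : F.lvl 0 → H.lvl 0} (hV : IsScDomain V) (hg : ScSmoothOn V g) (hf : ScSmoothOn U f)
    (hUV : MapsTo f U V) : ScSmoothOn U (g ∘ f) := by
  obtain ⟨fl, hf0, hfk⟩ := hf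
  obtain ⟨gl, hg0, hgk⟩ := hg
  have hUV' : MapsTo (fl 0) U V := hUV.congr hf0.symm
  refine ⟨fun m x => gl m (fl m x), fun x hx => ?_, fun k => (hgk k).comp hV (hfk k) hUV'⟩
  change gl 0 (fl 0 x) = g (f x)
  rw [hg0 (hUV' hx), hf0 hx]

open Classical in
/-- The restriction of `f : E₀ → F₀` to a map `E_m → F_m`, with junk value `0` at points that `f`
does not send to level `m`. -/
noncomputable def levelLift (f : E.lvl 0 → F.lvl 0) (m : ℕ) (x : E.lvl m) : F.lvl m :=
  if h : ∃ y, F.toZero m y = f (E.toZero m x) then h.choose else 0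

/-- The witness in the definition of sc-smoothness may be taken to be `levelLift f`, which does
not depend on the domain. -/
theorem ScSmoothOn.isSc_levelLift {U : Set (E.lvl 0)} {f : E.lvl 0 → F.lvl 0}
    (h : ScSmoothOn U f) (k : ℕ) : IsSc k E F U (levelLift f) := by
  obtain ⟨fl, h0, hk⟩ := h
  refine (hk k).congr fun m x hx => F.toZero_injective m ?_
  have e : F.toZero m (fl m x) = f (E.toZero m x) := ((hk 0).isSc0.toZero_eq m x hx).trans (h0 hx)
  have hex : ∃ y, F.toZero m y = f (E.toZero m x) := ⟨_, e⟩
  rw [levelLift, dif_pos hex, hex.choose_spec, e]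

theorem ScSmoothOn.of_locally {U : Set (E.lvl 0)} {f : E.lvl 0 → F.lvl 0} (hU : IsScDomain U)
    (h : ∀ x ∈ U, ∃ O, IsOpen O ∧ x ∈ O ∧ ScSmoothOn (U ∩ O) f) : ScSmoothOn U f := by
  refine ⟨levelLift f, fun x _ => ?_, fun k => IsSc.of_locally hU fun x hx => ?_⟩
  · have hex : ∃ y, F.toZero 0 y = f (E.toZero 0 x) := ⟨f x, rfl⟩
    rw [levelLift, dif_pos hex]
    exact hex.choose_spec
  · obtain ⟨O, hO, hxO, hf⟩ := h x hx
    exact ⟨O, hO, hxO, hf.isSc_levelLift k⟩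

/-! ### Partial quadrants and splicing cores -/

theorem IsPartialQuadrant.convex {E : ScBanach.{u}} {C : Set (E.lvl 0)}
    (hC : IsPartialQuadrant C) : Convex ℝ C := by
  obtain ⟨n, Q, T, -, rfl⟩ := hC
  intro x hx y hy a b ha hb hab i
  have := add_nonneg (mul_nonneg ha (hx i)) (mul_nonneg hb (hy i))
  simpa [map_add, map_smul] using this

theorem IsPartialQuadrant.uniqueDiffOn_levelSet {E : ScBanach.{u}} {C : Set (E.lvl 0)}
    (hC : IsPartialQuadrant C) (m : ℕ) : UniqueDiffOn ℝ (levelSet C m) := by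
  refine uniqueDiffOn_convex
    (hC.convex.is_linear_preimage (E.toZero m).toLinearMap.isLinear) ?_
  obtain ⟨n, Q, T, hT, rfl⟩ := hC
  have key : ∀ m (x : E.lvl m), (T 0 (E.toZero m x)).1 = (T m x).1 := by
    intro m
    induction m with
    | zero => intro x; rfl
    | succ k ih => intro x; rw [ScBanach.toZero_succ, ih, hT]
  have hopen : IsOpen (T m ⁻¹' ((univ.pi fun _ => Ioi 0) ×ˢ univ)) :=
    ((isOpen_set_pi finite_univ fun _ _ => isOpen_Ioi).prod isOpen_univ).preimage (T m).continuous
  refine ⟨(T m).symm (1, 0), interior_maximal ?_ hopen ?_⟩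
  · intro x hx i
    rw [key]
    exact (hx.1 i (mem_univ i)).le
  · simp

namespace Splicing

variable {S S' S'' : Splicing.{u}}

theorem retr_mem_core_iff {p : S.ambient.lvl 0} : S.retr p ∈ S.core ↔ p.1 ∈ S.V :=
  ⟨fun h => h.1, fun h => ⟨h, S.proj _ h _⟩⟩

theorem retr_coe (q : S.core) : S.retr q = q :=
  Prod.ext rfl q.2.2

theorem retr_coe_mem (q : S.core) : S.retr q ∈ S.core := by
  rw [retr_coe]; exact q.2

/-- The set of all `(v, e)` with `(v, π_v e) ∈ O`. -/
def retrPreimage (O : Set S.core) : Set (S.ambient.lvl 0) :=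
  {p | ∃ hp : S.retr p ∈ S.core, (⟨S.retr p, hp⟩ : S.core) ∈ O}

theorem coe_mem_retrPreimage {O : Set S.core} {q : S.core} (hq : q ∈ O) :
    (q : S.ambient.lvl 0) ∈ retrPreimage O :=
  ⟨retr_coe_mem q, by simpa only [retr_coe] using hq⟩

theorem continuousOn_retr : ContinuousOn S.retr {p | p.1 ∈ S.V} :=
  continuous_fst.continuousOn.prodMk S.smooth.continuousOn

theorem isScDomain_base : IsScDomain (E := S.ambient) {p | p.1 ∈ S.V} := by
  obtain ⟨O, hO, hV⟩ := S.isOpen_V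
  let l : S.ambient.lvl 0 →L[ℝ] S.W.lvl 0 := ContinuousLinearMap.fst ℝ _ _
  have hC : IsScDomain (E := S.ambient) (l ⁻¹' S.C) := by
    refine ⟨⟨univ, _, isOpen_univ,
      S.quadrant.convex.is_linear_preimage l.toLinearMap.isLinear, (univ_inter _).symm⟩,
      fun m => ?_⟩
    have : levelSet (E := S.ambient) (l ⁻¹' S.C) m = levelSet S.C m ×ˢ univ := by
      ext p
      have := ScBanach.toZero_prod S.W S.E m p
      change (S.ambient.toZero m p).1 ∈ S.C ↔ _
      rw [show S.ambient.toZero m p = _ from this]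
      simp [levelSet]
    rw [this]
    exact (S.quadrant.uniqueDiffOn_levelSet m).prod uniqueDiffOn_univ
  have h := hC.inter (hO.preimage l.continuous)
  rwa [← preimage_inter, inter_comm, ← hV] at h

/-- The preimage of an open set under the retraction is relatively open in `V ⊕ E`. -/
theorem exists_isOpen_retrPreimage {O : Set S.core} (hO : IsOpen O) :
    ∃ Ω : Set (S.ambient.lvl 0), IsOpen Ω ∧ retrPreimage O = {p | p.1 ∈ S.V} ∩ Ω := by
  obtain ⟨Ω, hΩ, rfl⟩ := isOpen_induced_iff.1 hO
  obtain ⟨Ω', hΩ', h⟩ := continuousOn_iff'.1 (continuousOn_retr (S := S)) Ω hΩ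
  refine ⟨Ω', hΩ', ?_⟩
  rw [inter_comm, ← h]
  ext p
  exact ⟨fun ⟨h1, h2⟩ => ⟨h2, h1.1⟩, fun ⟨h1, h2⟩ => ⟨retr_mem_core_iff.2 h2, h1⟩⟩

theorem isScDomain_retrPreimage {O : Set S.core} (hO : IsOpen O) :
    IsScDomain (retrPreimage O) := by
  obtain ⟨Ω, hΩ, h⟩ := exists_isOpen_retrPreimage hO
  rw [h]
  exact isScDomain_base.inter hΩ

open Classical in
/-- The map `(v, e) ↦ f(v, π_v e)`, with junk value `0` for `v ∉ V`. -/
noncomputable def extend (f : S.core → S'.core) (p : S.ambient.lvl 0) : S'.ambient.lvl 0 :=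
  if h : S.retr p ∈ S.core then f ⟨S.retr p, h⟩ else 0

theorem extend_of_mem (f : S.core → S'.core) {p : S.ambient.lvl 0} (h : S.retr p ∈ S.core) :
    extend f p = f ⟨S.retr p, h⟩ := dif_pos h

theorem extend_coe (f : S.core → S'.core) (q : S.core) : extend f q = f q := by
  rw [extend_of_mem f (retr_coe_mem q)]
  congr 2
  exact Subtype.ext (retr_coe q)

theorem scSmoothOnCore_iff {O : Set S.core} {f : S.core → S'.core} :
    ScSmoothOnCore S S' O f ↔ ScSmoothOn (retrPreimage O) (extend f) := by
  refine ⟨fun ⟨g, hg, hs⟩ => hs.congr fun p hp => ?_, fun h =>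
    ⟨extend f, fun p hp _ => extend_of_mem f hp, h⟩⟩
  obtain ⟨hp, hO⟩ := hp
  rw [hg p hp hO, extend_of_mem f hp]

theorem ScSmoothOnCore.mono_congr {O O' : Set S.core} {f g : S.core → S'.core}
    (h : ScSmoothOnCore S S' O f) (hO : O' ⊆ O) (hfg : EqOn f g O') :
    ScSmoothOnCore S S' O' g := by
  rw [scSmoothOnCore_iff] at h ⊢
  refine (h.mono (U' := retrPreimage O') fun p ⟨hp, hpO⟩ => ⟨hp, hO hpO⟩).congr ?_
  rintro p ⟨hp, hpO⟩
  rw [extend_of_mem f hp, extend_of_mem g hp, hfg hpO]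

theorem ScSmoothOnCore.comp {O : Set S.core} {O' : Set S'.core} {f : S.core → S'.core}
    {g : S'.core → S''.core} (hO' : IsOpen O') (hg : ScSmoothOnCore S' S'' O' g)
    (hf : ScSmoothOnCore S S' O f) (hfO : MapsTo f O O') :
    ScSmoothOnCore S S'' O (g ∘ f) := by
  rw [scSmoothOnCore_iff] at hf hg ⊢
  refine (hg.comp (isScDomain_retrPreimage hO') hf ?_).congr ?_
  · rintro p ⟨hp, hpO⟩
    rw [extend_of_mem f hp]
    exact coe_mem_retrPreimage (hfO hpO)
  · rintro p ⟨hp, -⟩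
    rw [Function.comp_apply, extend_of_mem f hp, extend_of_mem _ hp, extend_coe]
    rfl

theorem ScSmoothOnCore.of_locally {O : Set S.core} {f : S.core → S'.core} (hO : IsOpen O)
    (h : ∀ q ∈ O, ∃ O', IsOpen O' ∧ q ∈ O' ∧ ScSmoothOnCore S S' (O ∩ O') f) :
    ScSmoothOnCore S S' O f := by
  rw [scSmoothOnCore_iff]
  refine ScSmoothOn.of_locally (isScDomain_retrPreimage hO) ?_
  rintro p ⟨hp, hpO⟩
  obtain ⟨O', hO', hqO', hs⟩ := h _ hpO
  rw [scSmoothOnCore_iff] at hs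
  obtain ⟨Ω, hΩ, e⟩ := exists_isOpen_retrPreimage hO'
  have hpΩ : p ∈ retrPreimage O' := ⟨hp, hqO'⟩
  refine ⟨Ω, hΩ, (e ▸ hpΩ).2, hs.mono ?_⟩
  rintro p' ⟨⟨hp', hpO'⟩, hp'Ω⟩
  have : p' ∈ retrPreimage O' := e ▸ ⟨hp'.1, hp'Ω⟩
  exact ⟨hp', hpO', this.2⟩

end Splicing

/-! ### Coordinate representations -/

section Charts

variable {X Y Z : Type u} [TopologicalSpace X] [TopologicalSpace Y] [TopologicalSpace Z]
  {c : Chart X} {d : Chart Y} {e : Chart Z}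

theorem ScSmoothInCharts.mono {f : X → Y} {U U' : Set X} (h : ScSmoothInCharts c d f U)
    (hU : U' ⊆ U) : ScSmoothInCharts c d f U' :=
  Splicing.ScSmoothOnCore.mono_congr h (fun _ hq => ⟨hq.1, hU hq.2.1, hq.2.2⟩) fun _ _ => rfl

theorem ScSmoothInCharts.congr {f g : X → Y} {U : Set X} (h : ScSmoothInCharts c d f U)
    (hfg : EqOn f g U) : ScSmoothInCharts c d g U :=
  Splicing.ScSmoothOnCore.mono_congr h
    (fun _ hq => ⟨hq.1, hq.2.1, by rw [hfg hq.2.1]; exact hq.2.2⟩)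
    fun _ hq => congrArg d.φ (hfg hq.2.1)

theorem isOpen_chartDomain (c : Chart X) (d : Chart Y) {f : X → Y} {U : Set X} (hU : IsOpen U)
    (hf : ContinuousOn f U) :
    IsOpen {q | q ∈ c.φ.target ∧ c.φ.symm q ∈ U ∧ f (c.φ.symm q) ∈ d.φ.source} :=
  c.φ.isOpen_inter_preimage_symm (hf.isOpen_inter_preimage hU d.φ.open_source)

theorem ScSmoothInCharts.comp {f : X → Y} {g : Y → Z} {U U' : Set X} {V : Set Y}
    (hV : IsOpen V) (hgc : ContinuousOn g V) (hg : ScSmoothInCharts d e g V)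
    (hf : ScSmoothInCharts c d f U) (hU : U' ⊆ U) (hUV : MapsTo f U' V)
    (hUd : MapsTo f U' d.φ.source) : ScSmoothInCharts c e (g ∘ f) U' := by
  have hf' := hf.mono hU
  refine Splicing.ScSmoothOnCore.mono_congr
    (Splicing.ScSmoothOnCore.comp (isOpen_chartDomain d e hV hgc) hg
      (Splicing.ScSmoothOnCore.mono_congr hf'
        (O' := {q | q ∈ c.φ.target ∧ c.φ.symm q ∈ U' ∧ (g ∘ f) (c.φ.symm q) ∈ e.φ.source})
        (fun q hq => ⟨hq.1, hq.2.1, hUd hq.2.1⟩) fun _ _ => rfl) ?_) Subset.rfl ?_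
  · intro q hq
    have hd := hUd hq.2.1
    refine ⟨d.φ.map_source hd, ?_, ?_⟩
    · rw [d.φ.left_inv hd]; exact hUV hq.2.1
    · rw [d.φ.left_inv hd]; exact hq.2.2
  · intro q hq
    change e.φ (g (d.φ.symm (d.φ (f (c.φ.symm q))))) = _
    rw [d.φ.left_inv (hUd hq.2.1)]
    rfl

theorem ScSmoothInCharts.of_locally {f : X → Y} {U : Set X} (hU : IsOpen U)
    (hf : ContinuousOn f U)
    (h : ∀ x ∈ U, x ∈ c.φ.source → f x ∈ d.φ.source →
      ∃ W, IsOpen W ∧ x ∈ W ∧ ScSmoothInCharts c d f (U ∩ W)) : ScSmoothInCharts c d f U := by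
  refine Splicing.ScSmoothOnCore.of_locally (isOpen_chartDomain c d hU hf) fun q hq => ?_
  obtain ⟨W, hW, hxW, hs⟩ := h _ hq.2.1 (c.φ.map_target hq.1) hq.2.2
  refine ⟨c.φ.target ∩ c.φ.symm ⁻¹' W, c.φ.isOpen_inter_preimage_symm hW, ⟨hq.1, hxW⟩, ?_⟩
  exact Splicing.ScSmoothOnCore.mono_congr hs
    (fun q' hq' => ⟨hq'.1.1, ⟨hq'.1.2.1, hq'.2.2⟩, hq'.1.2.2⟩) fun _ _ => rfl

/-- Two charts are compatible in one direction if near every point they are so through a third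
chart. -/
theorem ScSmoothInCharts.id_trans {c c' : Chart X}
    (h : ∀ x, ∃ b : Chart X, x ∈ b.φ.source ∧ ScSmoothInCharts c b id univ ∧
      ScSmoothInCharts b c' id univ) : ScSmoothInCharts c c' id univ := by
  refine ScSmoothInCharts.of_locally isOpen_univ continuousOn_id fun x _ _ _ => ?_
  obtain ⟨b, hxb, h1, h2⟩ := h x
  exact ⟨b.φ.source, b.φ.open_source, hxb,
    h2.comp isOpen_univ continuousOn_id h1 (subset_univ _) (mapsTo_univ _ _) fun y hy => hy.2⟩

end Charts

/-! ### sc-smooth maps between M-polyfolds -/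

section Polyfold

variable {X Y Z : Type u} [TopologicalSpace X] [MPolyfold X] [TopologicalSpace Y] [MPolyfold Y]
  [TopologicalSpace Z] [MPolyfold Z]

theorem ScSmoothOnOpen.mono {f : X → Y} {U U' : Set X} (h : ScSmoothOnOpen f U) (hU : U' ⊆ U) :
    ScSmoothOnOpen f U' :=
  ⟨h.1.mono hU, fun c hc d hd => (h.2 c hc d hd).mono hU⟩

theorem ScSmoothOnOpen.congr {f g : X → Y} {U : Set X} (h : ScSmoothOnOpen f U)
    (hfg : EqOn f g U) : ScSmoothOnOpen g U :=
  ⟨h.1.congr hfg.symm, fun c hc d hd => (h.2 c hc d hd).congr hfg⟩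

theorem ScSmoothOnOpen.comp {f : X → Y} {g : Y → Z} {U : Set X} {V : Set Y} (hU : IsOpen U)
    (hV : IsOpen V) (hg : ScSmoothOnOpen g V) (hf : ScSmoothOnOpen f U) (hUV : MapsTo f U V) :
    ScSmoothOnOpen (g ∘ f) U := by
  refine ⟨hg.1.comp hf.1 hUV, fun c hc e he =>
    ScSmoothInCharts.of_locally hU (hg.1.comp hf.1 hUV) fun x hx _ _ => ?_⟩
  obtain ⟨d, hd, hxd⟩ := MPolyfold.covers (f x)
  refine ⟨U ∩ f ⁻¹' d.φ.source, hf.1.isOpen_inter_preimage hU d.φ.open_source, ⟨hx, hxd⟩, ?_⟩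
  exact (hg.2 d hd e he).comp hV hg.1 (hf.2 c hc d hd) inter_subset_left
    (fun y hy => hUV hy.1) fun y hy => hy.2.2

/-- Smoothness may be tested near each point in one suitable pair of charts. -/
theorem ScSmoothOnOpen.of_charts {f : X → Y} {U : Set X} (hU : IsOpen U) (hf : ContinuousOn f U)
    (h : ∀ x ∈ U, ∃ c ∈ MPolyfold.atlas (X := X), ∃ d ∈ MPolyfold.atlas (X := Y),
      ∃ W, IsOpen W ∧ x ∈ W ∧ x ∈ c.φ.source ∧ f x ∈ d.φ.source ∧
        ScSmoothInCharts c d f (U ∩ W)) : ScSmoothOnOpen f U := by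
  refine ⟨hf, fun c hc d hd => ScSmoothInCharts.of_locally hU hf fun x hx _ _ => ?_⟩
  obtain ⟨c₀, hc₀, d₀, hd₀, W, hW, hxW, hxc, hxd, hs⟩ := h x hx
  have h1 : ScSmoothInCharts c d₀ f (U ∩ W ∩ c₀.φ.source) :=
    hs.comp (f := id) (hU.inter hW) (hf.mono inter_subset_left)
      (MPolyfold.compatible c hc c₀ hc₀).1 (subset_univ _) (fun y hy => hy.1) fun y hy => hy.2
  refine ⟨W ∩ c₀.φ.source ∩ (U ∩ f ⁻¹' d₀.φ.source), (hW.inter c₀.φ.open_source).inter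
    (hf.isOpen_inter_preimage hU d₀.φ.open_source), ⟨⟨hxW, hxc⟩, hx, hxd⟩, ?_⟩
  exact (MPolyfold.compatible d₀ hd₀ d hd).1.comp (g := id) isOpen_univ continuousOn_id h1
    (fun y hy => ⟨⟨hy.1, hy.2.1.1⟩, hy.2.1.2⟩) (mapsTo_univ _ _) fun y hy => hy.2.2.2

theorem ScSmoothOnOpen.of_locally {f : X → Y} {U : Set X} (hU : IsOpen U)
    (h : ∀ x ∈ U, ∃ W, IsOpen W ∧ x ∈ W ∧ ScSmoothOnOpen f (U ∩ W)) : ScSmoothOnOpen f U := by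
  refine ScSmoothOnOpen.of_charts hU (fun x hx => ?_) fun x hx => ?_
  · obtain ⟨W, hW, hxW, hs⟩ := h x hx
    exact (hs.1 x ⟨hx, hxW⟩).mono_of_mem_nhdsWithin
      (Filter.inter_mem self_mem_nhdsWithin (mem_nhdsWithin_of_mem_nhds (hW.mem_nhds hxW)))
  · obtain ⟨W, hW, hxW, hs⟩ := h x hx
    obtain ⟨c, hc, hxc⟩ := MPolyfold.covers x
    obtain ⟨d, hd, hxd⟩ := MPolyfold.covers (f x)
    exact ⟨c, hc, d, hd, W, hW, hxW, hxc, hxd, hs.2 c hc d hd⟩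

theorem ScSmooth.continuous {f : X → Y} (h : ScSmooth f) : Continuous f :=
  continuousOn_univ.1 h.1

theorem scSmooth_id : ScSmooth (id : X → X) :=
  ⟨continuousOn_id, fun c hc d hd => (MPolyfold.compatible c hc d hd).1⟩

theorem ScSmooth.comp {f : X → Y} {g : Y → Z} (hg : ScSmooth g) (hf : ScSmooth f) :
    ScSmooth (g ∘ f) :=
  ScSmoothOnOpen.comp isOpen_univ isOpen_univ hg hf (mapsTo_univ _ _)

theorem ScSmooth.of_locally {f : X → Y} (h : ∀ x, ∃ W, IsOpen W ∧ x ∈ W ∧ ScSmoothOnOpen f W) :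
    ScSmooth f :=
  ScSmoothOnOpen.of_locally isOpen_univ fun x _ => by simpa using h x

/-- sc-smooth maps preserve the level filtration. -/
theorem ScSmoothOnOpen.mem_polyLevel {f : X → Y} {U : Set X} (h : ScSmoothOnOpen f U) {x : X}
    (hx : x ∈ U) {m : ℕ} (hxm : x ∈ polyLevel X m) : f x ∈ polyLevel Y m := by
  obtain ⟨c, hc, hxc, hm⟩ := hxm
  obtain ⟨d, hd, hxd⟩ := MPolyfold.covers (f x)
  refine ⟨d, hd, hxd, ?_⟩
  have hs := Splicing.scSmoothOnCore_iff.1 (h.2 c hc d hd)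
  have hmem : (c.φ x : c.S.ambient.lvl 0) ∈ Splicing.retrPreimage
      {q | q ∈ c.φ.target ∧ c.φ.symm q ∈ U ∧ f (c.φ.symm q) ∈ d.φ.source} := by
    refine Splicing.coe_mem_retrPreimage ⟨c.φ.map_source hxc, ?_, ?_⟩ <;>
      rw [c.φ.left_inv hxc] <;> assumption
  have := hs.mem_range_toZero hmem hm
  rwa [Splicing.extend_coe, c.φ.left_inv hxc] at this

/-- An M-polyfold structure is determined by the sc-smoothness of the identity in both
directions. -/
theorem MPolyfold.eq_of_scSmooth_id {X : Type u} [TopologicalSpace X] {A B : MPolyfold X}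
    (h : @ScSmooth X X _ A _ B id) (h' : @ScSmooth X X _ B _ A id) : A = B := by
  refine MPolyfold.ext (Subset.antisymm (fun c hc => ?_) fun c hc => ?_)
  · exact B.maximal c fun d hd => ⟨h.2 c hc d hd, h'.2 d hd c hc⟩
  · exact A.maximal c fun d hd => ⟨h'.2 c hc d hd, h.2 d hd c hc⟩

/-! ### Local sc-diffeomorphisms -/

theorem IsLocalScDiffeo.isLocalHomeomorph {f : X → Y} (h : IsLocalScDiffeo f) :
    IsLocalHomeomorph f :=
  IsLocalHomeomorph.mk f fun x => by
    obtain ⟨e, hx, he, -⟩ := h x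
    exact ⟨e, hx, he⟩

theorem IsLocalScDiffeo.comp {f : X → Y} {g : Y → Z} (hg : IsLocalScDiffeo g)
    (hf : IsLocalScDiffeo f) : IsLocalScDiffeo (g ∘ f) := by
  intro x
  obtain ⟨e, hx, he, hes, hes'⟩ := hf x
  obtain ⟨e', hx', he', hes2, hes2'⟩ := hg (f x)
  refine ⟨e.trans e', ?_, ?_, ?_, ?_⟩
  · rw [OpenPartialHomeomorph.trans_source]
    exact ⟨hx, by rw [mem_preimage, ← he hx]; exact hx'⟩
  · intro y hy
    rw [OpenPartialHomeomorph.trans_source] at hy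
    change g (f y) = e' (e y)
    rw [he hy.1, he' hy.2]
  · refine ScSmoothOnOpen.comp (f := e) (g := e') (e.trans e').open_source e'.open_source
      hes2 (hes.mono ?_) ?_ <;>
      rw [OpenPartialHomeomorph.trans_source]
    exacts [inter_subset_left, fun y hy => hy.2]
  · refine ScSmoothOnOpen.comp (f := e'.symm) (g := e.symm) (e.trans e').open_target e.open_target
      hes' (hes2'.mono ?_) ?_ <;>
      rw [OpenPartialHomeomorph.trans_target]
    exacts [inter_subset_left, fun y hy => hy.2]

/-- A continuous lift of an sc-smooth map through a local sc-diffeomorphism is sc-smooth. -/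
theorem IsLocalScDiffeo.scSmooth_of_comp {f : X → Y} {q : Y → Z} (hq : IsLocalScDiffeo q)
    (hf : Continuous f) (hqf : ScSmooth (q ∘ f)) : ScSmooth f := by
  refine ScSmooth.of_locally fun x => ?_
  obtain ⟨e, hx, he, -, hes⟩ := hq (f x)
  have hW := e.open_source.preimage hf
  refine ⟨_, hW, hx, ((hes.comp hW e.open_target (hqf.mono (subset_univ _)) ?_)).congr ?_⟩
  · intro y hy
    change q (f y) ∈ _
    rw [he hy]
    exact e.map_source hy
  · intro y hy
    change e.symm (q (f y)) = f y
    rw [he hy]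
    exact e.left_inv hy

/-- A continuous lift of a local sc-diffeomorphism through a local sc-diffeomorphism is a local
sc-diffeomorphism. -/
theorem IsLocalScDiffeo.of_comp {f : X → Y} {q : Y → Z} (hq : IsLocalScDiffeo q)
    (hf : Continuous f) (hqf : IsLocalScDiffeo (q ∘ f)) : IsLocalScDiffeo f := by
  intro x
  obtain ⟨e, hx, he, hes, hes'⟩ := hq (f x)
  obtain ⟨d, hxd, hd, hds, hds'⟩ := hqf x
  set d' := d.restrOpen _ (e.open_source.preimage hf)
  have key : ∀ y ∈ d'.source, d y = e (f y) ∧ f y ∈ e.source := by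
    intro y hy
    rw [OpenPartialHomeomorph.restrOpen_source] at hy
    exact ⟨(hd hy.1).symm.trans (he hy.2), hy.2⟩
  have hxd' : x ∈ d'.source := by
    rw [OpenPartialHomeomorph.restrOpen_source]; exact ⟨hxd, hx⟩
  have hsrc : (d'.trans e.symm).source ⊆ d'.source := by
    rw [OpenPartialHomeomorph.trans_source]; exact inter_subset_left
  have hd's : d'.source ⊆ d.source := by
    rw [OpenPartialHomeomorph.restrOpen_source]; exact inter_subset_left
  have heq : EqOn f (d'.trans e.symm) (d'.trans e.symm).source := by
    intro y hy
    obtain ⟨h1, h2⟩ := key y (hsrc hy)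
    change f y = e.symm (d y)
    rw [h1, e.left_inv h2]
  refine ⟨d'.trans e.symm, ?_, heq, ?_, ?_⟩
  · rw [OpenPartialHomeomorph.trans_source]
    refine ⟨hxd', ?_⟩
    change d x ∈ e.target
    rw [(key x hxd').1]
    exact e.map_source (key x hxd').2
  · refine ScSmoothOnOpen.comp (f := d) (d'.trans e.symm).open_source e.open_target hes'
      (hds.mono (hsrc.trans hd's)) fun y hy => ?_
    obtain ⟨h1, h2⟩ := key y (hsrc hy)
    rw [h1]
    exact e.map_source h2
  · refine ScSmoothOnOpen.comp (f := e) (g := d.symm) (d'.trans e.symm).open_target d.open_target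
      hds' (hes.mono ?_) ?_
    · rw [OpenPartialHomeomorph.trans_target]; exact inter_subset_left
    · rw [OpenPartialHomeomorph.trans_target]
      intro y hy
      have h1 : e y ∈ d'.target := hy.2
      have h2 : d'.symm (e y) ∈ d.source := hd's (d'.map_target h1)
      rw [← d'.right_inv h1]
      exact d.map_source h2

theorem IsLocalScDiffeo.scSmooth {f : X → Y} (h : IsLocalScDiffeo f) : ScSmooth f :=
  ScSmooth.of_locally fun x => by
    obtain ⟨e, hx, he, hes, -⟩ := h x
    exact ⟨_, e.open_source, hx, hes.congr he.symm⟩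

theorem IsLocalScDiffeo.mem_polyLevel_iff {f : X → Y} (h : IsLocalScDiffeo f) {x : X} {m : ℕ} :
    f x ∈ polyLevel Y m ↔ x ∈ polyLevel X m := by
  refine ⟨fun hx => ?_, fun hx => ScSmoothOnOpen.mem_polyLevel h.scSmooth (mem_univ x) hx⟩
  obtain ⟨e, hxe, he, -, hes⟩ := h x
  rw [he hxe] at hx
  have := hes.mem_polyLevel (e.map_source hxe) hx
  rwa [e.left_inv hxe] at this

end Polyfold

/-! ### Pulling back M-polyfold structures -/

section Pullback

variable {P Z : Type u} [TopologicalSpace P] [TopologicalSpace Z]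

/-- The chart `d ∘ e` of `P` obtained from a chart `d` of `Z` and a local homeomorphism `e`. -/
def Chart.pullback (d : Chart Z) (e : OpenPartialHomeomorph P Z) : Chart P := ⟨d.S, e.trans d.φ⟩

theorem Chart.mem_pullback_source {d : Chart Z} {e : OpenPartialHomeomorph P Z} {x : P} :
    x ∈ (d.pullback e).φ.source ↔ x ∈ e.source ∧ e x ∈ d.φ.source := by
  rw [Chart.pullback, OpenPartialHomeomorph.trans_source]; rfl

theorem Chart.mem_pullback_target {d : Chart Z} {e : OpenPartialHomeomorph P Z}
    {y : d.S.core} : y ∈ (d.pullback e).φ.target ↔ y ∈ d.φ.target ∧ d.φ.symm y ∈ e.target := by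
  simp only [Chart.pullback, OpenPartialHomeomorph.trans_target]; rfl

/-- The transition map between two charts pulled back by local branches of the same map is the
original transition map. -/
theorem ScSmoothInCharts.pullback {q : P → Z} {e e' : OpenPartialHomeomorph P Z}
    (he : EqOn q e e.source) (he' : EqOn q e' e'.source) {d d' : Chart Z}
    (h : ScSmoothInCharts d d' id univ) :
    ScSmoothInCharts (d.pullback e) (d'.pullback e') id univ := by
  have key : ∀ y, y ∈ (d.pullback e).φ.target →
      (d.pullback e).φ.symm y ∈ (d'.pullback e').φ.source →
      y ∈ d.φ.target ∧ e' ((d.pullback e).φ.symm y) = d.φ.symm y ∧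
        d.φ.symm y ∈ d'.φ.source := by
    intro y hy hy'
    have hy1 : y ∈ d.φ.target ∧ d.φ.symm y ∈ e.target :=
      Chart.mem_pullback_target.1 hy
    have hy2 : e.symm (d.φ.symm y) ∈ e'.source ∧ e' (e.symm (d.φ.symm y)) ∈ d'.φ.source :=
      Chart.mem_pullback_source.1 hy'
    have h1 : e' (e.symm (d.φ.symm y)) = d.φ.symm y := by
      rw [← he' hy2.1, he (e.map_target hy1.2), e.right_inv hy1.2]
    exact ⟨hy1.1, h1, h1 ▸ hy2.2⟩
  refine Splicing.ScSmoothOnCore.mono_congr h ?_ ?_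
  · rintro y ⟨hy, -, hy'⟩
    obtain ⟨h1, h2, h3⟩ := key y hy hy'
    exact ⟨h1, mem_univ _, h3⟩
  · rintro y ⟨hy, -, hy'⟩
    obtain ⟨h1, h2, h3⟩ := key y hy hy'
    exact congrArg d'.φ h2.symm

/-- A nice space with a local homeomorphism to an M-polyfold inherits an M-polyfold structure for
which this map is a local sc-diffeomorphism. -/
theorem exists_mPolyfold_isLocalScDiffeo [T2Space P] [SecondCountableTopology P]
    [ParacompactSpace P] [MPolyfold Z] {q : P → Z} (hq : IsLocalHomeomorph q) :
    ∃ _ : MPolyfold P, IsLocalScDiffeo q := by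
  let base : Set (Chart P) := {c | ∃ e : OpenPartialHomeomorph P Z, EqOn q e e.source ∧
    ∃ d ∈ MPolyfold.atlas (X := Z), c = d.pullback e}
  have hbase : ∀ c ∈ base, ∀ c' ∈ base, ScSmoothInCharts c c' id univ := by
    rintro _ ⟨e, he, d, hd, rfl⟩ _ ⟨e', he', d', hd', rfl⟩
    exact (MPolyfold.compatible d hd d' hd').1.pullback he he'
  have hcov : ∀ (e : OpenPartialHomeomorph P Z), ∀ x ∈ e.source, ∀ d : Chart Z,
      e x ∈ d.φ.source → x ∈ (d.pullback e).φ.source := fun e x hx d hd =>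
    Chart.mem_pullback_source.2 ⟨hx, hd⟩
  have hcovers : ∀ x : P, ∃ c ∈ base, x ∈ c.φ.source := by
    intro x
    obtain ⟨e, hx, he⟩ := hq x
    obtain ⟨d, hd, hxd⟩ := MPolyfold.covers (e x)
    exact ⟨d.pullback e, ⟨e, by rw [he]; exact fun _ _ => rfl, d, hd, rfl⟩, hcov e x hx d hxd⟩
  have hsub : ∀ c ∈ base, ∀ d ∈ base, c.Compatible d :=
    fun c hc d hd => ⟨hbase c hc d hd, hbase d hd c hc⟩
  let A : MPolyfold P :=
    { atlas := {c | ∀ b ∈ base, c.Compatible b}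
      t2 := inferInstance
      secondCountable := inferInstance
      paracompact := inferInstance
      covers := fun x => by
        obtain ⟨c, hc, hx⟩ := hcovers x
        exact ⟨c, hsub c hc, hx⟩
      compatible := by
        have : ∀ c c' : Chart P, (∀ b ∈ base, c.Compatible b) → (∀ b ∈ base, c'.Compatible b) →
            ScSmoothInCharts c c' id univ := fun c c' hc hc' =>
          ScSmoothInCharts.id_trans fun x => by
            obtain ⟨b, hb, hx⟩ := hcovers x
            exact ⟨b, hx, (hc b hb).1, (hc' b hb).2⟩
        exact fun c hc d hd => ⟨this c d hc hd, this d c hd hc⟩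
      maximal := fun c hc b hb => hc b (hsub b hb) }
  refine ⟨A, fun x => ?_⟩
  obtain ⟨e, hx, he⟩ := hq x
  have he' : EqOn q e e.source := by rw [he]; exact fun _ _ => rfl
  refine ⟨e, hx, he', ?_, ?_⟩
  · refine ScSmoothOnOpen.of_charts e.open_source e.continuousOn fun y hy => ?_
    obtain ⟨d, hd, hyd⟩ := MPolyfold.covers (e y)
    refine ⟨d.pullback e, hsub _ ⟨e, he', d, hd, rfl⟩, d, hd, univ, isOpen_univ, mem_univ _,
      hcov e y hy d hyd, hyd, ?_⟩
    refine Splicing.ScSmoothOnCore.mono_congr (MPolyfold.compatible d hd d hd).1 ?_ ?_ <;>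
      rintro z ⟨hz, -, -⟩ <;>
      have hz1 : z ∈ d.φ.target ∧ d.φ.symm z ∈ e.target :=
        Chart.mem_pullback_target.1 hz
    · exact ⟨hz1.1, mem_univ _, d.φ.map_target hz1.1⟩
    · exact congrArg d.φ (e.right_inv hz1.2).symm
  · refine ScSmoothOnOpen.of_charts e.open_target e.symm.continuousOn fun y hy => ?_
    obtain ⟨d, hd, hyd⟩ := MPolyfold.covers y
    refine ⟨d, hd, d.pullback e, hsub _ ⟨e, he', d, hd, rfl⟩, univ, isOpen_univ, mem_univ _, hyd,
      hcov e _ (e.map_target hy) d (by rwa [e.right_inv hy]), ?_⟩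
    refine Splicing.ScSmoothOnCore.mono_congr (MPolyfold.compatible d hd d hd).1 ?_ ?_
    · rintro z ⟨hz, -, -⟩
      exact ⟨hz, mem_univ _, d.φ.map_target hz⟩
    · rintro z ⟨hz, hz', -⟩
      exact congrArg d.φ (e.right_inv hz'.1).symm

end Pullback

/-! ### Fibered products along local homeomorphisms -/

/-- Local homeomorphisms are stable under base change. -/
theorem isLocalHomeomorph_of_pullback {P A B C : Type*} [TopologicalSpace P] [TopologicalSpace A]
    [TopologicalSpace B] [TopologicalSpace C] {f : A → B} (hf : IsLocalHomeomorph f) {b : C → B}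
    (hb : Continuous b) {a : P → A} {c : P → C} (hemb : IsEmbedding fun p => (a p, c p))
    (hcomm : ∀ p, f (a p) = b (c p)) (hex : ∀ x z, f x = b z → ∃ p, a p = x ∧ c p = z) :
    IsLocalHomeomorph c := by
  have ha : Continuous a := continuous_fst.comp hemb.continuous
  have hc : Continuous c := continuous_snd.comp hemb.continuous
  refine IsLocalHomeomorph.mk c fun p₀ => ?_
  obtain ⟨e, hp₀, rfl⟩ := hf (a p₀)
  have hsec : ∀ z, ∃ p, b z ∈ e.target → a p = e.symm (b z) ∧ c p = z := by
    intro z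
    by_cases hz : b z ∈ e.target
    · obtain ⟨p, hp⟩ := hex (e.symm (b z)) z (e.right_inv hz)
      exact ⟨p, fun _ => hp⟩
    · exact ⟨p₀, fun h => absurd h hz⟩
  choose σ hσ using hsec
  refine ⟨{ toFun := c, invFun := σ, source := a ⁻¹' e.source, target := b ⁻¹' e.target
            map_source' := fun p hp => ?_
            map_target' := fun z hz => ?_
            left_inv' := fun p hp => ?_
            right_inv' := fun z hz => (hσ z hz).2
            open_source := e.open_source.preimage ha
            open_target := e.open_target.preimage hb
            continuousOn_toFun := hc.continuousOn
            continuousOn_invFun := ?_ }, hp₀, fun _ _ => rfl⟩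
  · rw [mem_preimage, ← hcomm]; exact e.map_source hp
  · rw [mem_preimage, (hσ z hz).1]; exact e.map_target hz
  · have hz : b (c p) ∈ e.target := by rw [← hcomm]; exact e.map_source hp
    refine hemb.injective (Prod.ext ?_ (hσ _ hz).2)
    change a (σ (c p)) = a p
    rw [(hσ _ hz).1, ← hcomm]
    exact e.left_inv hp
  · rw [hemb.continuousOn_iff]
    exact ((e.symm.continuousOn.comp hb.continuousOn fun _ h => h).prodMk continuousOn_id).congr
      fun z hz => Prod.ext (hσ z hz).1 (hσ z hz).2

theorem MPolyfold.metrizableSpace (X : Type u) [TopologicalSpace X] [MPolyfold X] :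
    TopologicalSpace.MetrizableSpace X := by
  have := MPolyfold.t2 (X := X)
  have := MPolyfold.secondCountable (X := X)
  have := MPolyfold.paracompact (X := X)
  exact TopologicalSpace.metrizableSpace_of_t3_secondCountable X

section FiberedProduct

variable {P A B C D : Type u} [TopologicalSpace P] [TopologicalSpace A] [MPolyfold A]
  [TopologicalSpace B] [MPolyfold B] [TopologicalSpace C] [MPolyfold C] [TopologicalSpace D]
  [MPolyfold D]

theorem IsNaturalIn₂.scSmooth_fst [MPolyfold P] {a : P → A} {b : P → B}
    (h : IsNaturalIn₂ a b) : ScSmooth a := ((h.scSmooth_iff P id).1 scSmooth_id).1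

theorem IsNaturalIn₂.scSmooth_snd [MPolyfold P] {a : P → A} {b : P → B}
    (h : IsNaturalIn₂ a b) : ScSmooth b := ((h.scSmooth_iff P id).1 scSmooth_id).2

theorem IsNaturalIn₃.scSmooth_fst [MPolyfold P] {a : P → A} {b : P → B} {c : P → C}
    (h : IsNaturalIn₃ a b c) : ScSmooth a := ((h.scSmooth_iff P id).1 scSmooth_id).1

theorem IsNaturalIn₃.scSmooth_snd [MPolyfold P] {a : P → A} {b : P → B} {c : P → C}
    (h : IsNaturalIn₃ a b c) : ScSmooth b := ((h.scSmooth_iff P id).1 scSmooth_id).2.1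

theorem IsNaturalIn₃.scSmooth_trd [MPolyfold P] {a : P → A} {b : P → B} {c : P → C}
    (h : IsNaturalIn₃ a b c) : ScSmooth c := ((h.scSmooth_iff P id).1 scSmooth_id).2.2

theorem IsNaturalIn₃.eq_induced {P : Type u} {tP : TopologicalSpace P} {S : MPolyfold P}
    {a : P → A} {b : P → B} {c : P → C} (h : IsNaturalIn₃ a b c) :
    tP = TopologicalSpace.induced (fun p => (a p, b p, c p)) inferInstance :=
  h.embedding.eq_induced

theorem IsNaturalIn₃.mPolyfold_unique {S T : MPolyfold P} {a : P → A} {b : P → B} {c : P → C}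
    (h : @IsNaturalIn₃ P A B C _ S _ _ _ _ _ _ a b c)
    (h' : @IsNaturalIn₃ P A B C _ T _ _ _ _ _ _ a b c) : S = T :=
  MPolyfold.eq_of_scSmooth_id
    ((@IsNaturalIn₃.scSmooth_iff P A B C _ T _ _ _ _ _ _ a b c h' P _ S id).2
      ((@IsNaturalIn₃.scSmooth_iff P A B C _ S _ _ _ _ _ _ a b c h P _ S id).1
        (@scSmooth_id P _ S)))
    ((@IsNaturalIn₃.scSmooth_iff P A B C _ S _ _ _ _ _ _ a b c h P _ T id).2
      ((@IsNaturalIn₃.scSmooth_iff P A B C _ T _ _ _ _ _ _ a b c h' P _ T id).1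
        (@scSmooth_id P _ T)))

/-- The fibered product of a local sc-diffeomorphism `f : A → D` and an sc-smooth map `b : C → D`
carries a natural M-polyfold structure, pulled back from `C` along the projection, which is a local
homeomorphism. -/
theorem exists_isNaturalIn₂ {f : A → D} (hf : IsLocalScDiffeo f) {b : C → D} (hb : ScSmooth b)
    {a : P → A} {c : P → C} (hemb : IsEmbedding fun p => (a p, c p))
    (hcomm : ∀ p, f (a p) = b (c p)) (hex : ∀ x z, f x = b z → ∃ p, a p = x ∧ c p = z) :
    ∃ _ : MPolyfold P, IsLocalScDiffeo c ∧ IsNaturalIn₂ a c := by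
  have hc := isLocalHomeomorph_of_pullback hf.isLocalHomeomorph hb.continuous hemb hcomm hex
  have := MPolyfold.metrizableSpace A
  have := MPolyfold.metrizableSpace C
  have := MPolyfold.secondCountable (X := A)
  have := MPolyfold.secondCountable (X := C)
  have := hemb.metrizableSpace
  have := hemb.secondCountableTopology
  let := TopologicalSpace.metrizableSpaceMetric P
  obtain ⟨S, hS⟩ := exists_mPolyfold_isLocalScDiffeo hc
  have ha : ScSmooth a := by
    refine hf.scSmooth_of_comp (continuous_fst.comp hemb.continuous) ?_
    rw [show f ∘ a = b ∘ c from funext hcomm]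
    exact hb.comp hS.scSmooth
  refine ⟨S, hS, hemb, fun M _ _ w => ⟨fun hw => ⟨ha.comp hw, hS.scSmooth.comp hw⟩, ?_⟩⟩
  rintro ⟨h1, h2⟩
  exact hS.scSmooth_of_comp (hemb.continuous_iff.2 (h1.continuous.prodMk h2.continuous)) h2

/-- The set of triples `(x, φ, z)` with `σ φ = α x` and `τ φ = β z`, where `α` and `τ` are local
sc-diffeomorphisms, carries a natural M-polyfold structure: it is an iterated fibered product, first
of `τ` and `β`, then of `α` and `σ`. -/
theorem exists_isNaturalIn₃ {α : A → D} (hα : IsLocalScDiffeo α) {σ τ : B → D}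
    (hσ : ScSmooth σ) (hτ : IsLocalScDiffeo τ) {β : C → D} (hβ : ScSmooth β)
    {a : P → A} {b : P → B} {c : P → C} (hemb : IsEmbedding fun p => (a p, b p, c p))
    (h₁ : ∀ p, σ (b p) = α (a p)) (h₂ : ∀ p, τ (b p) = β (c p))
    (hex : ∀ x y z, σ y = α x → τ y = β z → ∃ p, a p = x ∧ b p = y ∧ c p = z) :
    ∃ _ : MPolyfold P, IsLocalScDiffeo c ∧ IsNaturalIn₃ a b c := by
  let Q : Type u := {q : B × C // τ q.1 = β q.2}
  obtain ⟨S, hS, hSn⟩ := exists_isNaturalIn₂ (P := Q) hτ hβ (a := fun q => q.1.1)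
    (c := fun q => q.1.2) IsEmbedding.subtypeVal (fun q => q.2)
    fun x z h => ⟨⟨(x, z), h⟩, rfl, rfl⟩
  let d : P → Q := fun p => ⟨(b p, c p), h₂ p⟩
  have ha : Continuous a := continuous_fst.comp hemb.continuous
  have hd : Continuous d := (continuous_snd.comp hemb.continuous).subtype_mk _
  have hemb' : IsEmbedding fun p => (a p, d p) :=
    IsEmbedding.of_comp (ha.prodMk hd) (g := fun y : A × {q : B × C // τ q.1 = β q.2} =>
      (y.1, y.2.1.1, y.2.1.2))
      (by fun_prop) hemb
  obtain ⟨T, hT, hTn⟩ := exists_isNaturalIn₂ hα (hσ.comp hSn.scSmooth_fst) hemb'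
    (fun p => (h₁ p).symm) fun x q h => by
      obtain ⟨p, h1, h2, h3⟩ := hex x q.1.1 q.1.2 h.symm q.2
      exact ⟨p, h1, Subtype.ext (Prod.ext h2 h3)⟩
  refine ⟨T, hS.comp hT, hemb, fun M _ _ w => (hTn.scSmooth_iff M w).trans ?_⟩
  exact and_congr_right fun _ => hSn.scSmooth_iff M (d ∘ w)

end FiberedProduct

/-! ### Groupoid algebra -/

namespace Grpd

variable (G : Grpd.{u})

theorem m_m_i (a g : G.Mor) (e : G.s a = G.t g) (e') : G.m (G.m a g e) (G.i g) e' = a := by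
  have e1 : G.s g = G.t (G.i g) := (G.t_i g).symm
  calc _ = G.m a (G.m g (G.i g) e1) (e.trans (G.t_m _ _ _).symm) := G.m_assoc _ _ _ e e1
    _ = G.m a (G.u (G.s a)) (G.t_u _).symm :=
      G.m_congr rfl ((G.m_i g).trans (congrArg G.u e.symm)) _ _
    _ = a := G.m_u a

theorem m_i_m (a g : G.Mor) (e : G.s a = G.t (G.i g)) (e') : G.m (G.m a (G.i g) e) g e' = a := by
  calc _ = G.m (G.m a (G.i g) e) (G.i (G.i g)) (e'.trans (congrArg G.t (G.i_i g).symm)) :=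
        G.m_congr rfl (G.i_i g).symm _ _
    _ = a := G.m_m_i _ _ _ _

theorem i_m_m (a g : G.Mor) (e : G.s a = G.t g) (e') : G.m (G.i a) (G.m a g e) e' = g := by
  have e1 : G.s (G.i a) = G.t a := G.s_i a
  calc _ = G.m (G.m (G.i a) a e1) g ((G.s_m _ _ _).trans e) := (G.m_assoc _ _ _ e1 e).symm
    _ = G.m (G.u (G.t g)) g (G.s_u _) := G.m_congr ((G.i_m a).trans (congrArg G.u e)) rfl _ _
    _ = g := G.u_m g

theorem m_i_m' (a g : G.Mor) (e : G.s (G.i a) = G.t g) (e') :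
    G.m a (G.m (G.i a) g e) e' = g := by
  calc _ = G.m (G.i (G.i a)) (G.m (G.i a) g e) ((congrArg G.s (G.i_i a)).trans e') :=
        G.m_congr (G.i_i a).symm rfl _ _
    _ = g := G.i_m_m _ _ _ _

theorem m_left_cancel {a g g' : G.Mor} (e : G.s a = G.t g) (e' : G.s a = G.t g')
    (h : G.m a g e = G.m a g' e') : g = g' := by
  have h1 := G.i_m_m a g e ((G.s_i a).trans (G.t_m _ _ _).symm)
  have h2 := G.i_m_m a g' e' ((G.s_i a).trans (G.t_m _ _ _).symm)
  rw [← h1, ← h2]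
  exact G.m_congr rfl h _ _

/-- `h ∘ φ ∘ g⁻¹ = ψ` means that the square with sides `φ`, `h`, `g`, `ψ` commutes. -/
theorem conj_eq_iff {h φ g ψ : G.Mor} (e : G.s h = G.t φ) (e' : G.s φ = G.s g)
    (d : G.s ψ = G.t g) : G.conj h φ g e e' = ψ ↔ G.m h φ e = G.m ψ g d := by
  constructor
  · rintro rfl
    exact (G.m_i_m _ _ _ _).symm
  · intro w
    have c : G.s (G.m ψ g d) = G.t (G.i g) := (G.s_m _ _ _).trans (G.t_i g).symm
    calc _ = G.m (G.m ψ g d) (G.i g) c := G.m_congr w rfl _ _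
      _ = ψ := G.m_m_i _ _ _ _

variable {G}

/-- A functor inducing an injection on orbit spaces and surjections on isotropy groups is full. -/
theorem Functor.exists_mor_eq {H : Grpd.{u}} (F : Functor G H)
    (hinj : Function.Injective F.orbitMap)
    (hiso : ∀ x, SurjOn F.mor (G.isotropy x) (H.isotropy (F.obj x))) {x x' : G.Obj} {ψ : H.Mor}
    (hs : H.s ψ = F.obj x) (ht : H.t ψ = F.obj x') :
    ∃ h, G.s h = x ∧ G.t h = x' ∧ F.mor h = ψ := by
  have horb : F.orbitMap (Quotient.mk G.orbitSetoid x) =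
      F.orbitMap (Quotient.mk G.orbitSetoid x') :=
    Quotient.sound (s := H.orbitSetoid) ⟨ψ, hs, ht⟩
  obtain ⟨h₀, rfl, rfl⟩ : ∃ g : G.Mor, G.s g = x ∧ G.t g = x' := Quotient.exact (hinj horb)
  have e : H.s (H.i (F.mor h₀)) = H.t ψ := (H.s_i _).trans ((F.t_mor h₀).trans ht.symm)
  obtain ⟨h₁, ⟨hs₁, ht₁⟩, hh₁⟩ := hiso (G.s h₀)
    (show H.m (H.i (F.mor h₀)) ψ e ∈ H.isotropy (F.obj (G.s h₀)) from
      ⟨(H.s_m _ _ _).trans hs, (H.t_m _ _ _).trans ((H.t_i _).trans (F.s_mor h₀))⟩)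
  refine ⟨G.m h₀ h₁ ht₁.symm, (G.s_m _ _ _).trans hs₁, G.t_m _ _ _, ?_⟩
  rw [F.mor_m]
  have e₂ : H.s (F.mor h₀) = H.t (H.m (H.i (F.mor h₀)) ψ e) :=
    ((H.t_m _ _ _).trans (H.t_i _)).symm
  calc _ = H.m (F.mor h₀) (H.m (H.i (F.mor h₀)) ψ e) e₂ := H.m_congr rfl hh₁ _ _
    _ = ψ := H.m_i_m' _ _ _ _

section Weak

variable {X Y Z : Grpd.{u}} {F : Functor X Y} {G : Functor Z Y}

theorem WeakMor.target_eq_iff {g : WeakMor F G} {l : WeakObj F G} :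
    g.target = l ↔ X.t g.h = l.x ∧ Z.t g.k = l.z ∧
      ∃ e, Y.m (G.mor g.k) g.φ g.t_φ.symm = Y.m l.φ (F.mor g.h) e := by
  constructor
  · rintro rfl
    refine ⟨rfl, rfl, Y.s_conj _ _ _ g.t_φ.symm g.s_h.symm, ?_⟩
    exact (Y.conj_eq_iff _ g.s_h.symm _).1 rfl
  · rintro ⟨h1, h2, e, h3⟩
    exact WeakObj.ext h1 ((Y.conj_eq_iff _ g.s_h.symm e).2 h3) h2

/-- The morphism `φ'⁻¹ ∘ G(k) ∘ φ : F(x) → F(x')` for objects `(x, φ, z)`, `(x', φ', z')` of the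
weak fibered product and a morphism `k : z → z'`. -/
def WeakObj.transport (l l' : WeakObj F G) (k : Z.Mor) (hs : Z.s k = l.z) (ht : Z.t k = l'.z) :
    Y.Mor :=
  Y.m (Y.i l'.φ)
    (Y.m (G.mor k) l.φ ((G.s_mor k).trans ((congrArg G.obj hs).trans l.t_φ.symm)))
    ((Y.s_i _).trans (l'.t_φ.trans
      ((Y.t_m _ _ _).trans ((G.t_mor k).trans (congrArg G.obj ht))).symm))

theorem WeakObj.s_transport (l l' : WeakObj F G) (k : Z.Mor) (hs ht) :
    Y.s (l.transport l' k hs ht) = F.obj l.x :=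
  (Y.s_m _ _ _).trans ((Y.s_m _ _ _).trans l.s_φ)

theorem WeakObj.t_transport (l l' : WeakObj F G) (k : Z.Mor) (hs ht) :
    Y.t (l.transport l' k hs ht) = F.obj l'.x :=
  (Y.t_m _ _ _).trans ((Y.t_i _).trans l'.s_φ)

/-- A pair of morphisms `h`, `k` with `F(h) = φ'⁻¹ ∘ G(k) ∘ φ` is a morphism of the weak fibered
product. -/
theorem WeakObj.exists_weakMor (l l' : WeakObj F G) {h : X.Mor} {k : Z.Mor} (hs : Z.s k = l.z)
    (ht : Z.t k = l'.z) (hs' : X.s h = l.x) (ht' : X.t h = l'.x)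
    (hF : F.mor h = l.transport l' k hs ht) :
    ∃ g : WeakMor F G, g.source = l ∧ g.target = l' ∧ g.k = k := by
  refine ⟨⟨h, l.φ, k, ?_, ?_⟩, WeakObj.ext hs' rfl hs, ?_, rfl⟩
  · rw [F.s_mor, hs', l.s_φ]
  · rw [G.s_mor, hs, l.t_φ]
  · have e : Y.s l'.φ = Y.t (l.transport l' k hs ht) :=
      l'.s_φ.trans (WeakObj.t_transport l l' k hs ht).symm
    refine WeakMor.target_eq_iff.2 ⟨ht', ht, e.trans (congrArg Y.t hF.symm), ?_⟩
    calc _ = Y.m l'.φ (l.transport l' k hs ht) e := (Y.m_i_m' _ _ _ _).symm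
      _ = _ := Y.m_congr rfl hF.symm _ _

/-- A morphism of the weak fibered product is determined by its source, its target and its
component `k`, if `F` is faithful. -/
theorem WeakMor.ext_of_faithful {g g' : WeakMor F G} (hs : g.source = g'.source)
    (ht : g.target = g'.target) (hk : g.k = g'.k)
    (hF : F.mor g.h = F.mor g'.h → g.h = g'.h) : g = g' := by
  have hφ : g.φ = g'.φ := congrArg WeakObj.φ hs
  obtain ⟨-, -, e, h⟩ := WeakMor.target_eq_iff.1 ht
  obtain ⟨-, -, e', h'⟩ := WeakMor.target_eq_iff.1 (rfl : g'.target = g'.target)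
  refine WeakMor.ext (hF (Y.m_left_cancel e e' ?_)) hφ hk
  rw [← h, ← h']
  exact Y.m_congr (congrArg G.mor hk) hφ _ _

theorem orbitMap_weakProj_injective (hinj : Function.Injective F.orbitMap)
    (hiso : ∀ x, SurjOn F.mor (X.isotropy x) (Y.isotropy (F.obj x))) :
    Function.Injective (weakProj F G).orbitMap := by
  rintro ⟨l⟩ ⟨l'⟩ h
  obtain ⟨k, hs, ht⟩ : ∃ k : Z.Mor, Z.s k = WeakObj.z l ∧ Z.t k = WeakObj.z l' := Quotient.exact h
  obtain ⟨h, hs', ht', hh⟩ := F.exists_mor_eq hinj hiso (WeakObj.s_transport l l' k hs ht)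
    (WeakObj.t_transport l l' k hs ht)
  obtain ⟨g, hgs, hgt, -⟩ := WeakObj.exists_weakMor l l' hs ht hs' ht' hh
  exact Quotient.sound (s := (weakFiberedProduct F G).orbitSetoid) ⟨g, hgs, hgt⟩

theorem orbitMap_weakProj_surjective (hsurj : Function.Surjective F.orbitMap) :
    Function.Surjective (weakProj F G).orbitMap := by
  rintro ⟨z⟩
  obtain ⟨⟨x⟩, hx⟩ := hsurj (Quotient.mk _ (G.obj z))
  obtain ⟨φ, hs, ht⟩ : ∃ φ : Y.Mor, Y.s φ = F.obj x ∧ Y.t φ = G.obj z := Quotient.exact hx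
  exact ⟨Quotient.mk (weakFiberedProduct F G).orbitSetoid (⟨x, φ, z, hs, ht⟩ : WeakObj F G), rfl⟩

theorem bijOn_isotropy_weakProj
    (hiso : ∀ x, BijOn F.mor (X.isotropy x) (Y.isotropy (F.obj x)))
    (l : (weakFiberedProduct F G).Obj) :
    BijOn (weakProj F G).mor ((weakFiberedProduct F G).isotropy l)
      (Z.isotropy ((weakProj F G).obj l)) := by
  refine ⟨?_, ?_, ?_⟩
  · rintro g ⟨hs, ht⟩
    exact ⟨congrArg WeakObj.z hs, congrArg WeakObj.z ht⟩
  · rintro g ⟨hs, ht⟩ g' ⟨hs', ht'⟩ hk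
    refine WeakMor.ext_of_faithful (hs.trans hs'.symm) (ht.trans ht'.symm) hk fun e =>
      (hiso (WeakObj.x l)).injOn ?_ ?_ e
    · exact ⟨congrArg WeakObj.x hs, congrArg WeakObj.x ht⟩
    · exact ⟨congrArg WeakObj.x hs', congrArg WeakObj.x ht'⟩
  · rintro k ⟨hs, ht⟩
    obtain ⟨h, ⟨hs', ht'⟩, hh⟩ := (hiso (WeakObj.x l)).surjOn
      ⟨WeakObj.s_transport l l k hs ht, WeakObj.t_transport l l k hs ht⟩
    obtain ⟨g, hgs, hgt, hgk⟩ := WeakObj.exists_weakMor l l hs ht hs' ht' hh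
    exact ⟨g, ⟨hgs, hgt⟩, hgk⟩

/-- A morphism `k` of `Z` starting at `z` lifts to the morphism `(1, φ, k)` starting at
`(x, φ, z)`. -/
theorem exists_lift_weakProj (l : (weakFiberedProduct F G).Obj) (k : Z.Mor)
    (hs : Z.s k = (weakProj F G).obj l) :
    ∃ g, (weakFiberedProduct F G).s g = l ∧ (weakProj F G).mor g = k := by
  let l' : WeakObj F G := l
  exact ⟨(⟨X.u l'.x, l'.φ, k, by rw [F.s_mor, X.s_u, l'.s_φ],
    (l'.t_φ.trans (congrArg G.obj hs.symm)).trans (G.s_mor k).symm⟩ : WeakMor F G),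
    WeakObj.ext (X.s_u _) rfl hs, rfl⟩

end Weak

end Grpd

/-! ### The ep-groupoid structure of the weak fibered product -/

namespace EpGroupoid

variable {X Y Z : EpGroupoid.{u}}

/-- Multiplication in an ep-groupoid preserves sc-smoothness. -/
theorem scSmooth_mul (Y : EpGroupoid.{u}) {M : Type u} [TopologicalSpace M] [MPolyfold M]
    {f g : M → Y.toGrpd.Mor} (hf : ScSmooth f) (hg : ScSmooth g)
    (e : ∀ p, Y.toGrpd.s (f p) = Y.toGrpd.t (g p)) :
    ScSmooth fun p => Y.toGrpd.m (f p) (g p) (e p) := by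
  obtain ⟨S, hS, hm⟩ := Y.str.m_smooth
  have hw : ScSmooth fun p => (⟨(f p, g p), e p⟩ : Y.toGrpd.Composable) :=
    (hS.scSmooth_iff M _).2 ⟨hf, hg⟩
  exact hm.comp hw

theorem s_smooth (X : EpGroupoid.{u}) : ScSmooth X.toGrpd.s := X.str.s_smooth
theorem t_smooth (X : EpGroupoid.{u}) : ScSmooth X.toGrpd.t := X.str.t_smooth
theorem u_smooth (X : EpGroupoid.{u}) : ScSmooth X.toGrpd.u := X.str.u_smooth
theorem i_smooth (X : EpGroupoid.{u}) : ScSmooth X.toGrpd.i := X.str.i_smooth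
theorem s_etale (X : EpGroupoid.{u}) : IsLocalScDiffeo X.toGrpd.s := X.str.s_etale
theorem t_etale (X : EpGroupoid.{u}) : IsLocalScDiffeo X.toGrpd.t := X.str.t_etale

variable (F : Grpd.Functor X.toGrpd Y.toGrpd) (G : Grpd.Functor Z.toGrpd Y.toGrpd)

/-- The subspace topology on the objects of the weak fibered product. -/
instance weakObjTopology : TopologicalSpace (Grpd.weakFiberedProduct F G).Obj :=
  TopologicalSpace.induced (fun p : Grpd.WeakObj F G => (p.x, p.φ, p.z)) inferInstance

/-- The subspace topology on the morphisms of the weak fibered product. -/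
instance weakMorTopology : TopologicalSpace (Grpd.weakFiberedProduct F G).Mor :=
  TopologicalSpace.induced (fun p : Grpd.WeakMor F G => (p.h, p.φ, p.k)) inferInstance

theorem isEmbedding_weakObj : IsEmbedding fun p : (Grpd.weakFiberedProduct F G).Obj =>
    (Grpd.WeakObj.x p, Grpd.WeakObj.φ p, Grpd.WeakObj.z p) :=
  ⟨⟨rfl⟩, fun _ _ h => Grpd.WeakObj.ext (congrArg Prod.fst h)
    (congrArg (fun y => y.2.1) h) (congrArg (fun y => y.2.2) h)⟩

theorem isEmbedding_weakMor : IsEmbedding fun p : (Grpd.weakFiberedProduct F G).Mor =>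
    (Grpd.WeakMor.h p, Grpd.WeakMor.φ p, Grpd.WeakMor.k p) :=
  ⟨⟨rfl⟩, fun _ _ h => Grpd.WeakMor.ext (congrArg Prod.fst h)
    (congrArg (fun y => y.2.1) h) (congrArg (fun y => y.2.2) h)⟩

variable {F G}

theorem exists_isNaturalIn₃_weakObj (hF : IsLocalScDiffeo F.obj) (hG : ScSmooth G.obj) :
    ∃ _ : MPolyfold (Grpd.weakFiberedProduct F G).Obj,
      IsLocalScDiffeo (X := (Grpd.weakFiberedProduct F G).Obj) Grpd.WeakObj.z ∧
      IsNaturalIn₃ (P := (Grpd.weakFiberedProduct F G).Obj) Grpd.WeakObj.x Grpd.WeakObj.φ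
        Grpd.WeakObj.z :=
  exists_isNaturalIn₃ hF Y.s_smooth Y.t_etale hG (isEmbedding_weakObj F G)
    Grpd.WeakObj.s_φ Grpd.WeakObj.t_φ fun x φ z h₁ h₂ => ⟨⟨x, φ, z, h₁, h₂⟩, rfl, rfl, rfl⟩

theorem exists_isNaturalIn₃_weakMor (hF : IsLocalScDiffeo F.mor) (hG : ScSmooth G.mor) :
    ∃ _ : MPolyfold (Grpd.weakFiberedProduct F G).Mor,
      IsLocalScDiffeo (X := (Grpd.weakFiberedProduct F G).Mor) Grpd.WeakMor.k ∧
      IsNaturalIn₃ (P := (Grpd.weakFiberedProduct F G).Mor) Grpd.WeakMor.h Grpd.WeakMor.φ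
        Grpd.WeakMor.k :=
  exists_isNaturalIn₃ (Y.s_etale.comp hF) Y.s_smooth Y.t_etale (Y.s_smooth.comp hG)
    (isEmbedding_weakMor F G) (fun p => p.s_h.symm) Grpd.WeakMor.t_φ
    fun h φ k h₁ h₂ => ⟨⟨h, φ, k, h₁.symm, h₂⟩, rfl, rfl, rfl⟩

/-- The composition `φ' = G(k) ∘ φ ∘ F(h)⁻¹` depends sc-smoothly on `(h, φ, k)`. -/
theorem scSmooth_weakMor_φ' [MPolyfold (Grpd.weakFiberedProduct F G).Mor]
    (hF : ScSmooth F.mor) (hG : ScSmooth G.mor)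
    (hM : IsNaturalIn₃ (P := (Grpd.weakFiberedProduct F G).Mor) Grpd.WeakMor.h Grpd.WeakMor.φ
      Grpd.WeakMor.k) :
    ScSmooth (X := (Grpd.weakFiberedProduct F G).Mor) Grpd.WeakMor.φ' :=
  Y.scSmooth_mul (Y.scSmooth_mul (hG.comp hM.scSmooth_trd) hM.scSmooth_snd fun p => p.t_φ.symm)
    (Y.i_smooth.comp (hF.comp hM.scSmooth_fst)) _

/-- Properness of the weak fibered product follows from properness of its two factors: `φ` is
recovered from `h`, `k` and the component `φ'` of the target. -/
theorem isProperMap_weak_target [MPolyfold (Grpd.weakFiberedProduct F G).Obj]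
    (hO : IsNaturalIn₃ (P := (Grpd.weakFiberedProduct F G).Obj) Grpd.WeakObj.x Grpd.WeakObj.φ
      Grpd.WeakObj.z)
    (hs : Continuous (Grpd.weakFiberedProduct F G).s)
    (ht : Continuous (Grpd.weakFiberedProduct F G).t)
    (hi : Continuous (Grpd.weakFiberedProduct F G).i)
    (p : (Grpd.weakFiberedProduct F G).Obj) :
    ∃ V : Set (Grpd.weakFiberedProduct F G).Obj, IsOpen V ∧ p ∈ V ∧
      IsProperMap (fun g : {g : (Grpd.weakFiberedProduct F G).Mor //
        (Grpd.weakFiberedProduct F G).s g ∈ closure V} => (Grpd.weakFiberedProduct F G).t g) := by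
  obtain ⟨VX, hVX, hpX, hpropX⟩ := X.str.proper (Grpd.WeakObj.x p)
  obtain ⟨VZ, hVZ, hpZ, hpropZ⟩ := Z.str.proper (Grpd.WeakObj.z p)
  have hx : Continuous (X := (Grpd.weakFiberedProduct F G).Obj) Grpd.WeakObj.x :=
    hO.scSmooth_fst.continuous
  have hφ : Continuous (X := (Grpd.weakFiberedProduct F G).Obj) Grpd.WeakObj.φ :=
    hO.scSmooth_snd.continuous
  have hz : Continuous (X := (Grpd.weakFiberedProduct F G).Obj) Grpd.WeakObj.z :=
    hO.scSmooth_trd.continuous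
  set V : Set (Grpd.weakFiberedProduct F G).Obj :=
    Grpd.WeakObj.x ⁻¹' VX ∩ Grpd.WeakObj.z ⁻¹' VZ
  let S : Type u := {g : (Grpd.weakFiberedProduct F G).Mor //
    (Grpd.weakFiberedProduct F G).s g ∈ closure V}
  have hclX : ∀ g : S, X.toGrpd.s (Grpd.WeakMor.h g.1) ∈ closure VX :=
    fun g => hx.closure_preimage_subset _ (closure_mono inter_subset_left g.2)
  have hclZ : ∀ g : S, Z.toGrpd.s (Grpd.WeakMor.k g.1) ∈ closure VZ :=
    fun g => hz.closure_preimage_subset _ (closure_mono inter_subset_right g.2)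
  refine ⟨V, (hVX.preimage hx).inter (hVZ.preimage hz), ⟨hpX, hpZ⟩, ?_⟩
  rw [isProperMap_iff_ultrafilter]
  refine ⟨ht.comp continuous_subtype_val, fun 𝒰 l hl => ?_⟩
  obtain ⟨⟨h, _⟩, hht, hh⟩ := (isProperMap_iff_ultrafilter.1 hpropX).2
    (𝒰 := 𝒰.map fun g => ⟨_, hclX g⟩) (y := Grpd.WeakObj.x l) ((hx.tendsto l).comp hl)
  obtain ⟨⟨k, _⟩, hkt, hk⟩ := (isProperMap_iff_ultrafilter.1 hpropZ).2
    (𝒰 := 𝒰.map fun g => ⟨_, hclZ g⟩) (y := Grpd.WeakObj.z l) ((hz.tendsto l).comp hl)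
  have hh' : Filter.Tendsto (fun g : S => Grpd.WeakMor.h g.1) 𝒰 (𝓝 h) :=
    (continuous_subtype_val.tendsto _).comp hh
  have hk' : Filter.Tendsto (fun g : S => Grpd.WeakMor.k g.1) 𝒰 (𝓝 k) :=
    (continuous_subtype_val.tendsto _).comp hk
  dsimp only at hht hkt
  -- The inverses `(h⁻¹, φ', k⁻¹)` converge, their components being controlled by the targets.
  obtain ⟨r, hrh, hrφ, hrk⟩ : ∃ r : (Grpd.weakFiberedProduct F G).Mor,
      Grpd.WeakMor.h r = X.toGrpd.i h ∧ Grpd.WeakMor.φ r = Grpd.WeakObj.φ l ∧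
      Grpd.WeakMor.k r = Z.toGrpd.i k :=
    ⟨(⟨_, _, _, (F.s_mor _).trans ((congrArg F.obj ((X.toGrpd.s_i h).trans hht)).trans
        (Grpd.WeakObj.s_φ l).symm),
      (Grpd.WeakObj.t_φ l).trans ((congrArg G.obj ((Z.toGrpd.s_i k).trans hkt)).symm.trans
        (G.s_mor _).symm)⟩ : Grpd.WeakMor F G), rfl, rfl, rfl⟩
  have hr : Filter.Tendsto (fun g : S => (Grpd.weakFiberedProduct F G).i g.1) 𝒰 (𝓝 r) := by
    refine (isEmbedding_weakMor F G).tendsto_nhds_iff.2 ?_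
    rw [hrh, hrφ, hrk]
    exact ((X.i_smooth.continuous.tendsto h).comp hh').prodMk_nhds
      (((hφ.tendsto l).comp hl).prodMk_nhds ((Z.i_smooth.continuous.tendsto k).comp hk'))
  have hg : Filter.Tendsto (fun g : S => g.1) 𝒰 (𝓝 ((Grpd.weakFiberedProduct F G).i r)) := by
    refine ((hi.tendsto _).comp hr).congr fun g => ?_
    exact Grpd.i_i _ _
  have hmem : (Grpd.weakFiberedProduct F G).s ((Grpd.weakFiberedProduct F G).i r) ∈ closure V :=
    isClosed_closure.mem_of_tendsto ((hs.tendsto _).comp hg) (Filter.Eventually.of_forall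
      fun g => g.2)
  refine ⟨⟨(Grpd.weakFiberedProduct F G).i r, hmem⟩, ?_, ?_⟩
  · refine (Grpd.t_i _ r).trans (Grpd.WeakObj.ext ?_ hrφ ?_)
    · exact (congrArg X.toGrpd.s hrh).trans ((X.toGrpd.s_i h).trans hht)
    · exact (congrArg Z.toGrpd.s hrk).trans ((Z.toGrpd.s_i k).trans hkt)
  · rw [nhds_subtype_eq_comap]
    exact Filter.tendsto_iff_comap.1 hg

/-- The weak fibered product is an ep-groupoid in a natural way, and the components of its
projection to `Z` are local sc-diffeomorphisms. -/
theorem exists_epStructure_weak (hF : IsScSmooth F) (hFo : IsLocalScDiffeo F.obj)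
    (hFm : IsLocalScDiffeo F.mor) (hG : IsScSmooth G) :
    ∃ 𝓛 : EpStructure (Grpd.weakFiberedProduct F G), IsNaturalWeak F G 𝓛 ∧
      @IsLocalScDiffeo _ _ 𝓛.topObj 𝓛.polyObj _ _ (Grpd.weakProj F G).obj ∧
      @IsLocalScDiffeo _ _ 𝓛.topMor 𝓛.polyMor _ _ (Grpd.weakProj F G).mor := by
  obtain ⟨SO, hOd, hO⟩ := exists_isNaturalIn₃_weakObj hFo hG.1
  obtain ⟨SM, hMd, hM⟩ := exists_isNaturalIn₃_weakMor hFm hG.2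
  set L := Grpd.weakFiberedProduct F G
  have hφ' := scSmooth_weakMor_φ' hF.2 hG.2 hM
  have hs : ScSmooth L.s := (hO.scSmooth_iff _ _).2
    ⟨X.s_smooth.comp hM.scSmooth_fst, hM.scSmooth_snd, Z.s_smooth.comp hM.scSmooth_trd⟩
  have ht : ScSmooth L.t := (hO.scSmooth_iff _ _).2
    ⟨X.t_smooth.comp hM.scSmooth_fst, hφ', Z.t_smooth.comp hM.scSmooth_trd⟩
  have hu : ScSmooth L.u := (hM.scSmooth_iff _ _).2
    ⟨X.u_smooth.comp hO.scSmooth_fst, hO.scSmooth_snd, Z.u_smooth.comp hO.scSmooth_trd⟩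
  have hi : ScSmooth L.i := (hM.scSmooth_iff _ _).2
    ⟨X.i_smooth.comp hM.scSmooth_fst, hφ', Z.i_smooth.comp hM.scSmooth_trd⟩
  -- The projection to `Z` intertwines the sources (targets), so étaleness is inherited from `Z`.
  have hse : IsLocalScDiffeo L.s := hOd.of_comp hs.continuous (Z.s_etale.comp hMd)
  have hte : IsLocalScDiffeo L.t := hOd.of_comp ht.continuous (Z.t_etale.comp hMd)
  obtain ⟨SC, -, hC⟩ := exists_isNaturalIn₂ (P := L.Composable) hse ht (a := fun p => p.1.1)
    (c := fun p => p.1.2) IsEmbedding.subtypeVal (fun p => p.2)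
    fun x z h => ⟨⟨(x, z), h⟩, rfl, rfl⟩
  have hm : ScSmooth fun p : L.Composable => L.m p.1.1 p.1.2 p.2 := by
    have h₂ := hM.scSmooth_snd.comp hC.scSmooth_snd
    refine (hM.scSmooth_iff _ _).2 ⟨?_, h₂, ?_⟩
    · exact X.scSmooth_mul (hM.scSmooth_fst.comp hC.scSmooth_fst)
        (hM.scSmooth_fst.comp hC.scSmooth_snd) fun p => congrArg Grpd.WeakObj.x p.2
    · exact Z.scSmooth_mul (hM.scSmooth_trd.comp hC.scSmooth_fst)
        (hM.scSmooth_trd.comp hC.scSmooth_snd) fun p => congrArg Grpd.WeakObj.z p.2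
  exact ⟨{ s_smooth := hs
           t_smooth := ht
           u_smooth := hu
           i_smooth := hi
           m_smooth := ⟨SC, hC, hm⟩
           s_surjective := fun x => ⟨L.u x, L.s_u x⟩
           t_surjective := fun x => ⟨L.u x, L.t_u x⟩
           s_etale := hse
           t_etale := hte
           proper := isProperMap_weak_target hO hs.continuous ht.continuous hi.continuous },
    ⟨hO, hM⟩, hOd, hMd⟩

/-- The conditions of naturality determine the ep-groupoid structure. -/
theorem IsNaturalWeak.unique {𝓛 𝓛' : EpStructure (Grpd.weakFiberedProduct F G)}
    (h : IsNaturalWeak F G 𝓛) (h' : IsNaturalWeak F G 𝓛') : 𝓛 = 𝓛' := by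
  obtain @⟨tO, tM, pO, pM⟩ := 𝓛
  obtain @⟨tO', tM', pO', pM'⟩ := 𝓛'
  obtain ⟨hO, hM⟩ := h
  obtain ⟨hO', hM'⟩ := h'
  obtain rfl : tO = tO' := hO.eq_induced.trans hO'.eq_induced.symm
  obtain rfl : tM = tM' := hM.eq_induced.trans hM'.eq_induced.symm
  obtain rfl := hO.mPolyfold_unique hO'
  obtain rfl := hM.mPolyfold_unique hM'
  rfl

/-! ### The projection is an equivalence -/

/-- The orbit projection of an ep-groupoid is open, since the saturation `t(s⁻¹(U))` of an open set
`U` is open. -/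
theorem isOpenMap_orbit_mk (X : EpGroupoid.{u}) :
    IsOpenMap (Quotient.mk X.toGrpd.orbitSetoid) := by
  intro U hU
  have hq : IsQuotientMap (Quotient.mk X.toGrpd.orbitSetoid) := isQuotientMap_quotient_mk'
  rw [← hq.isOpen_preimage]
  have : Quotient.mk X.toGrpd.orbitSetoid ⁻¹' (Quotient.mk X.toGrpd.orbitSetoid '' U) =
      X.toGrpd.t '' (X.toGrpd.s ⁻¹' U) := by
    ext y
    constructor
    · rintro ⟨x, hx, hxy⟩
      obtain ⟨g, rfl, rfl⟩ : ∃ g : X.toGrpd.Mor, X.toGrpd.s g = x ∧ X.toGrpd.t g = y :=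
        Quotient.exact hxy
      exact ⟨g, hx, rfl⟩
    · rintro ⟨g, hg, rfl⟩
      exact ⟨_, hg, Quotient.sound (s := X.toGrpd.orbitSetoid) ⟨g, rfl, rfl⟩⟩
  rw [this]
  exact X.t_etale.isLocalHomeomorph.isOpenMap _ (hU.preimage X.s_smooth.continuous)

/-- A functor that is a local sc-diffeomorphism on objects induces a continuous open map of orbit
spaces, hence a homeomorphism if the induced map is bijective. -/
theorem isHomeomorph_orbitMap {F : Grpd.Functor X.toGrpd Y.toGrpd} (hF : IsLocalScDiffeo F.obj)
    (hbij : Function.Bijective F.orbitMap) : IsHomeomorph F.orbitMap := by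
  have hq : IsQuotientMap (Quotient.mk X.toGrpd.orbitSetoid) := isQuotientMap_quotient_mk'
  have hq' : IsQuotientMap (Quotient.mk Y.toGrpd.orbitSetoid) := isQuotientMap_quotient_mk'
  refine ⟨hq.continuous_iff.2 (hq'.continuous.comp hF.scSmooth.continuous), ?_, hbij⟩
  intro U hU
  have : F.orbitMap '' U = Quotient.mk Y.toGrpd.orbitSetoid ''
      (F.obj '' (Quotient.mk X.toGrpd.orbitSetoid ⁻¹' U)) := by
    rw [image_image, ← image_preimage_eq U hq.surjective, image_image,
      preimage_image_preimage]
    rfl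
  rw [this]
  exact isOpenMap_orbit_mk Y _ (hF.isLocalHomeomorph.isOpenMap _ (hU.preimage hq.continuous))

/-- A criterion for equivalences, in which the condition on the levels of the orbit spaces is
replaced by the lifting of morphisms with given source. -/
theorem IsEquivalence.of_isLocalScDiffeo {F : Grpd.Functor X.toGrpd Y.toGrpd}
    (hO : IsLocalScDiffeo F.obj) (hM : IsLocalScDiffeo F.mor)
    (hbij : Function.Bijective F.orbitMap)
    (hiso : ∀ x, BijOn F.mor (X.toGrpd.isotropy x) (Y.toGrpd.isotropy (F.obj x)))
    (hlift : ∀ x k, Y.toGrpd.s k = F.obj x → ∃ g, X.toGrpd.s g = x ∧ F.mor g = k) :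
    IsEquivalence F := by
  refine ⟨⟨hO.scSmooth, hM.scSmooth⟩, hO, hM, isHomeomorph_orbitMap hO hbij,
    fun m q => ⟨?_, ?_⟩, hiso⟩
  · obtain ⟨x, rfl⟩ := Quotient.exists_rep q
    rintro ⟨y, hy, hxy⟩
    obtain ⟨k, hs, rfl⟩ : ∃ k : Y.toGrpd.Mor, Y.toGrpd.s k = F.obj x ∧ Y.toGrpd.t k = y :=
      Quotient.exact hxy.symm
    obtain ⟨g, rfl, rfl⟩ := hlift x k hs
    rw [F.t_mor] at hy
    exact ⟨X.toGrpd.t g, hO.mem_polyLevel_iff.1 hy,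
      (Quotient.sound (s := X.toGrpd.orbitSetoid) ⟨g, rfl, rfl⟩).symm⟩
  · rintro ⟨x, hx, rfl⟩
    exact ⟨_, hO.mem_polyLevel_iff.2 hx, rfl⟩

end EpGroupoid

end ScGeom

theorem mainTheorem7 (X Y Z : ScGeom.EpGroupoid.{u})
    (F : ScGeom.Grpd.Functor X.toGrpd Y.toGrpd) (G : ScGeom.Grpd.Functor Z.toGrpd Y.toGrpd)
    (hF : ScGeom.EpGroupoid.IsEquivalence F) (hG : ScGeom.EpGroupoid.IsScSmooth G) :
    ∃ 𝓛 : ScGeom.EpStructure (ScGeom.Grpd.weakFiberedProduct F G),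
      ScGeom.EpGroupoid.IsNaturalWeak F G 𝓛 ∧
      (∀ 𝓛' : ScGeom.EpStructure (ScGeom.Grpd.weakFiberedProduct F G),
        ScGeom.EpGroupoid.IsNaturalWeak F G 𝓛' → 𝓛' = 𝓛) ∧
      ScGeom.EpGroupoid.IsEquivalence (X := ⟨ScGeom.Grpd.weakFiberedProduct F G, 𝓛⟩) (Y := Z)
        (ScGeom.Grpd.weakProj F G) := by
  obtain ⟨𝓛, h, hO, hM⟩ :=
    ScGeom.EpGroupoid.exists_epStructure_weak hF.scSmooth hF.obj_local hF.mor_local hG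
  refine ⟨𝓛, h, fun 𝓛' h' => h'.unique h,
    ScGeom.EpGroupoid.IsEquivalence.of_isLocalScDiffeo hO hM ⟨?_, ?_⟩ ?_ ?_⟩
  · exact ScGeom.Grpd.orbitMap_weakProj_injective hF.orbit_homeo.injective
      fun x => (hF.isotropy_bij x).surjOn
  · exact ScGeom.Grpd.orbitMap_weakProj_surjective hF.orbit_homeo.surjective
  · exact ScGeom.Grpd.bijOn_isotropy_weakProj hF.isotropy_bij
  · exact ScGeom.Grpd.exists_lift_weakProj
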